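/- Conventions. A graph $G$ on $[0,n]=\{0,1,\dots,n\}$ is finite, loopless, may have multiple edges (copies of an edge are regarded as distinct elements of $E(G)$), and its edges $(i,j)$ are directed from the smaller to the larger vertex: $i<j$. All unions and images are those of multisets (unions are disjoint). $G\setminus S$ means deletion of a set $S$ of vertices (with all incident edges) or of edges. *Reductions.* If $r_1=(i,j)$ and $r_2=(j,k)$ are edges of $H$, $i<j<k$, the reduction of $H$ on $r_1,r_2$ produces the graphs $H_1,H_2,H_3$ with edges $E(H)\setminus\{r_2\}\cup\{(i,k)\}$, $E(H)\setminus\{r_1\}\cup\{(i,k)\}$ and $E(H)\setminus\{r_1,r_2\}\cup\{(i,k)\}$. A reduction tree of $G$ has root labelled $G$; each node either is a leaf, labelled by a graph which cannot be reduced, or has three children labelled $H_1,H_2,H_3$ by a reduction of its label $H$. The special reduction tree $\mathcal T(G)$ treats the restrictions $G[0,1],G[0,2],\dots,G[0,n]$ of $G$ to the vertices $[0,i]$ successively: $\mathcal T(G[0,i+1])$ arises from $\mathcal T(G[0,i])$ by adding the vertex $i+1$ and all edges into it to all graphs, and then performing, below the leaves, all reductions possible at the vertices $v$ with $(v,i+1)\in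 E(G)$, always using the longest edges possible at $v$. (Whatever is not determined by this, the order of the vertices $v$ and the choice among parallel edges, may be chosen arbitrarily.) $\mathrm{InSeq}(\mathcal T(G))$ is the multiset of the left-degree sequences $(\mathrm{indeg}_L(1),\dots,\mathrm{indeg}_L(n))$ over all leaves $L$. To a leaf $L$ assign the set $F$ of all edges $r_2$ over the steps $H\to H_3$ on the path from the root to $L$; for $F\subseteq E(G\setminus 0)$, $\mathrm{LD}(G,F)$ is the multiset of left-degree sequences of those leaves of $\mathcal T(G)$ that are assigned $F$. *Constraint arrays.* For $F\subseteq E(G\setminus 0)$ let $f_{i,j}=\#\{(j,k)\in F: k\le i\}$ and let $\mu_{j,i}$ be the number of edges $(j,i)$ of $G$. $\mathrm{Sol}_G(F)$ is the set of integer arrays $\big(a^{(m)}_{i,j}\big)$, $1\le j\le i\le n$, $1\le m\le\max(1,\mu_{j,i})$, such that - $f_{n,j}\le a^{(1)}_{n,j}+f_{n,j}$ for $1\le j\le n$; - for $1\le j<i\le n$: $a^{(1)}_{i,j}+f_{i,j}=a^{(1)}_{i-1,j}+f_{i-1,j}$ if $\mu_{j,i}=0$, and otherwise, with $\mu=\mu_{j,i}$,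 $a^{(1)}_{i,j}+f_{i,j}\le a^{(2)}_{i,j}+f_{i,j}\le\dots\le a^{(\mu)}_{i,j}+f_{i,j}\le a^{(1)}_{i-1,j}+f_{i-1,j}$; - $a^{(1)}_{i,i}=\#E(G[0,i])-\sum_{k=1}^{i-1}\big(a^{(1)}_{i,k}+f_{i,k}\big)$ for $1\le i\le n$. Let $\rho$ map such an array to its first column $\big(a^{(1)}_{n,1},\dots,a^{(1)}_{n,n}\big)$. *Flows.* $\widetilde G$ is $G$ with a new smallest vertex $s$, a new largest vertex $t$, and the edges $(s,i)$, $(i,t)$ for $i\in[0,n]$. A flow on a graph $H$ with netflow vector $\mathbf a$ is $f:E(H)\to\mathbb R_{\ge0}$ such that, for each vertex $v$, $\sum_{e\text{ out of }v}f(e)-\sum_{e\text{ into }v}f(e)=a_v$; the flow polytope $\mathcal F_H(\mathbf a)$ is the set of these. Let $\psi$ map a flow on $\widetilde G\setminus\{s,0\}$ to the tuple of its values on the edges $(j,t)$, $j=1,\dots,n$, and let $$\mathbf b_G^F=\big(\mathrm{indeg}_G(1)-\mathrm{outdeg}_F(1),\dots,\mathrm{indeg}_G(n)-\mathrm{outdeg}_F(n),\,-\#E(G\setminus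 F)\big).$$ **Theorem.** Let $G$ be a graph on $[0,n]$. The special reduction tree $\mathcal T(G)$ exists, and for each $F\subseteq E(G\setminus 0)$, as multisets, $$\mathrm{LD}(G,F)=\rho\big(\mathrm{Sol}_G(F)\big)=\psi\Big(\mathcal F_{\widetilde G\setminus\{s,0\}}(\mathbf b_G^F)\cap\mathbb Z^{E(\widetilde G\setminus\{s,0\})}\Big).$$ Moreover $$\mathrm{InSeq}(\mathcal T(G))=\bigcup_{F\subseteq E(G\setminus0)}\mathrm{LD}(G,F)=\bigcup_{F\subseteq E(G\setminus0)}\rho\big(\mathrm{Sol}_G(F)\big)=\bigcup_{F\subseteq E(G\setminus0)}\psi\Big(\mathcal F_{\widetilde G\setminus\{s,0\}}(\mathbf b_G^F)\cap\mathbb Z^{E(\widetilde G\setminus\{s,0\})}\Big).$$ If $G$ is simple, then also $\{\mathrm{Arr}(L): L\text{ a leaf of }\mathcal T(G)\}=\bigcup_{F\subseteq E(G\setminus 0)}\mathrm{Sol}_G(F)$ as multisets, where $\mathrm{Arr}(L)=(a_{i,j})_{1\le j\le i\le n}$ and $(a_{i,1},\dots,a_{i,i})$ is the left-degree sequence of the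 leaf of $\mathcal T(G[0,i])$ that precedes (or, if $i=n$, equals) $L$ in the construction of $\mathcal T(G)$. -/

import Mathlib

open Finset

/-- A finite loopless directed graph whose edges, possibly multiple, are distinguished by their
names in `E` and are directed from smaller to larger vertices. The values of `src` and `tgt` on
names outside `edges` are irrelevant. -/
structure MGraph (V : Type*) (E : Type*) [LinearOrder V] where
  verts : Finset V
  edges : Finset E
  src : E → V
  tgt : E → V
  src_mem : ∀ e ∈ edges, src e ∈ verts
  tgt_mem : ∀ e ∈ edges, tgt e ∈ verts
  src_lt_tgt : ∀ e ∈ edges, src e < tgt e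

namespace MGraph

section General

variable {V E : Type*} [LinearOrder V] [DecidableEq E]

/-- The number of edges directed into `v`. -/
def indeg (G : MGraph V E) (v : V) : ℕ := #{e ∈ G.edges | G.tgt e = v}

/-- The number of edges of the edge set `F` that are directed out of `v`. -/
def outdegIn (G : MGraph V E) (F : Finset E) (v : V) : ℕ := #{e ∈ F | G.src e = v}

/-- `G ∖ S`: delete the vertices in `S` and all edges incident to them. -/
def deleteVerts (G : MGraph V E) (S : Finset V) : MGraph V E where
  verts := G.verts \ S
  edges := {e ∈ G.edges | G.src e ∉ S ∧ G.tgt e ∉ S}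
  src := G.src
  tgt := G.tgt
  src_mem e he := by
    rw [mem_filter] at he
    exact mem_sdiff.2 ⟨G.src_mem e he.1, he.2.1⟩
  tgt_mem e he := by
    rw [mem_filter] at he
    exact mem_sdiff.2 ⟨G.tgt_mem e he.1, he.2.2⟩
  src_lt_tgt e he := G.src_lt_tgt e (mem_filter.1 he).1

/-! ### The graph with an added source and sink -/

/-- The vertex `s` of `G̃`. -/
abbrev source : WithBot (WithTop V) := ⊥

/-- The vertex `t` of `G̃`. -/
abbrev sink : WithBot (WithTop V) := ((⊤ : WithTop V) : WithBot (WithTop V))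

/-- A vertex `v` of `G` as a vertex of `G̃`. -/
abbrev inner (v : V) : WithBot (WithTop V) := ((v : WithTop V) : WithBot (WithTop V))

/-- `G̃`: add a smallest vertex `s` and a largest vertex `t`, together with one edge `(s, i)`,
named `inr (inl i)`, and one edge `(i, t)`, named `inr (inr i)`, for each vertex `i` of `G`. -/
def tilde (G : MGraph V E) : MGraph (WithBot (WithTop V)) (E ⊕ (V ⊕ V)) where
  verts := insert source (insert sink (G.verts.image inner))
  edges := G.edges.disjSum (G.verts.disjSum G.verts)
  src
    | .inl e => inner (G.src e)
    | .inr (.inl _) => source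
    | .inr (.inr i) => inner i
  tgt
    | .inl e => inner (G.tgt e)
    | .inr (.inl i) => inner i
    | .inr (.inr _) => sink
  src_mem e he := by
    rcases e with e | i | i <;> simp at he ⊢
    · exact G.src_mem e he
    · exact he
  tgt_mem e he := by
    rcases e with e | i | i <;> simp at he ⊢
    · exact G.tgt_mem e he
    · exact he
  src_lt_tgt e he := by
    rcases e with e | i | i <;> simp at he ⊢
    · exact G.src_lt_tgt e he
    · exact WithBot.coe_lt_coe.2 (WithTop.coe_lt_top i)

/-! ### Flows -/

/-- The flow polytope of `G` with netflow vector `a`. -/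
def flowPolytope (G : MGraph V E) (a : V → ℝ) : Set (G.edges → ℝ) :=
  {f | (∀ e, 0 ≤ f e) ∧ ∀ v ∈ G.verts,
    (∑ e : G.edges with G.src e.1 = v, f e) - (∑ e : G.edges with G.tgt e.1 = v, f e) = a v}

/-- The integer points of the flow polytope of `G` with integral netflow vector `a`. -/
def integralFlows (G : MGraph V E) (a : V → ℤ) : Set (G.edges → ℤ) :=
  {f | (fun e => (f e : ℝ)) ∈ G.flowPolytope fun v => (a v : ℝ)}

theorem integralFlows_finite (G : MGraph V E) (a : V → ℤ) : (G.integralFlows a).Finite := by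
  classical
  let φ : V → ℕ := fun v => #{u ∈ G.verts | v < u}
  have hφ : ∀ e ∈ G.edges, φ (G.tgt e) + 1 ≤ φ (G.src e) := by
    intro e he
    have h1 := G.src_lt_tgt e he
    apply Finset.card_lt_card
    rw [Finset.ssubset_iff_of_subset]
    · exact ⟨G.tgt e, by simp [G.tgt_mem e he, h1], by simp⟩
    · intro u hu
      simp only [mem_filter] at hu ⊢
      exact ⟨hu.1, h1.trans hu.2⟩
  let B : ℝ := ∑ v ∈ G.verts, (φ v : ℝ) * (a v : ℝ)
  have key : ∀ f ∈ G.flowPolytope (fun v => (a v : ℝ)), ∀ e, f e ≤ B := by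
    intro f hf e
    have hs : ∀ (g : E → V), (∀ e ∈ G.edges, g e ∈ G.verts) →
        ∑ v ∈ G.verts, (φ v : ℝ) * ∑ e : G.edges with g e.1 = v, f e
          = ∑ e : G.edges, (φ (g e.1) : ℝ) * f e := by
      intro g hg
      rw [← Finset.sum_fiberwise_of_maps_to (s := univ) (t := G.verts)
        (g := fun e : G.edges => g e.1) (fun e _ => hg e e.2)]
      refine Finset.sum_congr rfl fun v _ => ?_
      rw [Finset.mul_sum]
      refine Finset.sum_congr rfl fun e he => ?_
      rw [(mem_filter.1 he).2]
    have hB : B = ∑ e : G.edges, ((φ (G.src e.1) : ℝ) - φ (G.tgt e.1)) * f e := by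
      calc B = ∑ v ∈ G.verts, (φ v : ℝ) * ((∑ e : G.edges with G.src e.1 = v, f e)
                - (∑ e : G.edges with G.tgt e.1 = v, f e)) :=
            Finset.sum_congr rfl fun v hv => by rw [hf.2 v hv]
        _ = _ := by
            simp only [mul_sub, Finset.sum_sub_distrib, sub_mul]
            rw [hs _ G.src_mem, hs _ G.tgt_mem]
    have h1 : ∀ e : G.edges, f e ≤ ((φ (G.src e.1) : ℝ) - φ (G.tgt e.1)) * f e := by
      intro e
      have h2 : ((φ (G.tgt e.1) : ℝ) + 1) ≤ φ (G.src e.1) := by exact_mod_cast hφ e e.2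
      nlinarith [hf.1 e]
    rw [hB]
    exact (h1 e).trans (Finset.single_le_sum
      (f := fun e : G.edges => ((φ (G.src e.1) : ℝ) - φ (G.tgt e.1)) * f e)
      (fun e _ => (hf.1 e).trans (h1 e)) (mem_univ e))
  refine (Set.Finite.pi' (t := fun _ : G.edges => Set.Icc (0 : ℤ) ⌊B⌋)
    fun _ => Set.finite_Icc _ _).subset ?_
  intro f hf e
  have h0 : (0 : ℝ) ≤ (f e : ℝ) := hf.1 e
  exact ⟨by exact_mod_cast h0, Int.le_floor.2 (key _ hf e)⟩

/-! ### Reductions and reduction trees -/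

/-- `r₁ = (i, j)` and `r₂ = (j, k)` are edges of `G`, for some vertices `i < j < k`. -/
structure IsReducible (G : MGraph V E) (r₁ r₂ : E) : Prop where
  mem₁ : r₁ ∈ G.edges
  mem₂ : r₂ ∈ G.edges
  comp : G.tgt r₁ = G.src r₂

/-- The first graph of the reduction on `r₁ = (i, j)`, `r₂ = (j, k)`: remove `r₂` and add a new
edge `(i, k)`, which reuses the name of the removed edge. -/
def red₁ (G : MGraph V E) {r₁ r₂ : E} (h : G.IsReducible r₁ r₂) : MGraph V E where
  verts := G.verts
  edges := G.edges
  src := Function.update G.src r₂ (G.src r₁)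
  tgt := G.tgt
  src_mem e he := by
    by_cases hr : e = r₂
    · subst hr; simpa using G.src_mem _ h.mem₁
    · simpa [Function.update_of_ne hr] using G.src_mem e he
  tgt_mem := G.tgt_mem
  src_lt_tgt e he := by
    by_cases hr : e = r₂
    · subst hr
      simpa using (G.src_lt_tgt _ h.mem₁).trans (h.comp ▸ G.src_lt_tgt _ h.mem₂)
    · simpa [Function.update_of_ne hr] using G.src_lt_tgt e he

/-- The second graph of the reduction on `r₁ = (i, j)`, `r₂ = (j, k)`: remove `r₁` and add a new
edge `(i, k)`, which reuses the name of the removed edge. -/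
def red₂ (G : MGraph V E) {r₁ r₂ : E} (h : G.IsReducible r₁ r₂) : MGraph V E where
  verts := G.verts
  edges := G.edges
  src := G.src
  tgt := Function.update G.tgt r₁ (G.tgt r₂)
  src_mem := G.src_mem
  tgt_mem e he := by
    by_cases hr : e = r₁
    · subst hr; simpa using G.tgt_mem _ h.mem₂
    · simpa [Function.update_of_ne hr] using G.tgt_mem e he
  src_lt_tgt e he := by
    by_cases hr : e = r₁
    · subst hr
      simpa using (G.src_lt_tgt _ h.mem₁).trans (h.comp ▸ G.src_lt_tgt _ h.mem₂)
    · simpa [Function.update_of_ne hr] using G.src_lt_tgt e he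

/-- The third graph of the reduction on `r₁ = (i, j)`, `r₂ = (j, k)`: remove `r₁` and `r₂` and add
a new edge `(i, k)`, which reuses the name `r₁`. -/
def red₃ (G : MGraph V E) {r₁ r₂ : E} (h : G.IsReducible r₁ r₂) : MGraph V E where
  verts := G.verts
  edges := G.edges.erase r₂
  src := G.src
  tgt := Function.update G.tgt r₁ (G.tgt r₂)
  src_mem e he := G.src_mem e (mem_of_mem_erase he)
  tgt_mem e he := (G.red₂ h).tgt_mem e (mem_of_mem_erase he)
  src_lt_tgt e he := (G.red₂ h).src_lt_tgt e (mem_of_mem_erase he)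

/-- A reduction tree with root labelled by `G`: a node either is a leaf, labelled by a graph that
cannot be reduced, or has three children, obtained from one reduction on its label. -/
inductive ReductionTree : MGraph V E → Type _
  | leaf (G : MGraph V E) (h : ∀ r₁ r₂, ¬ G.IsReducible r₁ r₂) : ReductionTree G
  | node (G : MGraph V E) {r₁ r₂ : E} (h : G.IsReducible r₁ r₂)
      (t₁ : ReductionTree (G.red₁ h)) (t₂ : ReductionTree (G.red₂ h))
      (t₃ : ReductionTree (G.red₃ h)) : ReductionTree G

/-- The special reduction tree: it treats `G[0,1]`, `G[0,2]`, ..., `G[0,n]` successively, and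
reduces on the longest edges possible at the vertex of the reduction. So in each reduction, on
`r₁ = (i, j)` and `r₂ = (j, k)`:
* `k` is minimal among all possible reductions (the restriction of the current graph to the
  vertices below `k` cannot be reduced any more);
* `r₁` is a longest edge into `j`; and `r₂` is a longest edge out of `j` in the restriction of the
  current graph to the vertices up to `k`, as it ends in `k`.
The order in which the vertices `j` are treated for one `k`, and the choice among parallel copies
of a longest edge, are left free. -/
def ReductionTree.IsSpecial : {G : MGraph V E} → ReductionTree G → Prop
  | _, .leaf _ _ => True
  | _, .node G (r₁ := r₁) (r₂ := r₂) _ t₁ t₂ t₃ =>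
      (∀ r₁' r₂', G.IsReducible r₁' r₂' → G.tgt r₂ ≤ G.tgt r₂') ∧
      (∀ e ∈ G.edges, G.tgt e = G.tgt r₁ → G.src r₁ ≤ G.src e) ∧
      t₁.IsSpecial ∧ t₂.IsSpecial ∧ t₃.IsSpecial

end General

section Fin

variable {n : ℕ} {E : Type*} [DecidableEq E]

/-! ### Left-degree sequences and arrays of the leaves -/

/-- The left-degree sequence `(indeg 1, ..., indeg n)` of a graph on `[0,n]`. -/
def leftDegSeq (G : MGraph (Fin (n + 1)) E) : Fin n → ℤ := fun j => (G.indeg j.succ : ℤ)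

/-- The triangular array with `(i, j)` entry `indeg j` for `1 ≤ j ≤ i ≤ n` (and `0` for all other
`i`, `j`). -/
def degArray (G : MGraph (Fin (n + 1)) E) (i j : ℕ) : ℤ :=
  if 1 ≤ j ∧ j ≤ i ∧ i ≤ n then (#{e ∈ G.edges | (G.tgt e : ℕ) = j} : ℤ) else 0

/-- A leaf of a reduction tree: the graph that labels it; the set of the edges `r₂` over all steps
of the path from the root which go to a third child of a reduction on `r₁`, `r₂` (in a special reduction tree such an `r₂` is
always an edge of the graph at the root, with its original end points); and the triangular array
`Arr` of the leaf. -/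
structure LeafRecord (n : ℕ) (E : Type*) where
  graph : MGraph (Fin (n + 1)) E
  labels : Finset E
  arr : ℕ → ℕ → ℤ

/-- The multiset of leaves of a reduction tree. In a special reduction tree, `T(G[0,i])` consists of
the reductions on `(x, j)`, `(j, k)` with `k ≤ i`; row `i` of the array of a leaf is the left-degree
sequence of the leaf of `T(G[0,i])` preceding it, that is, of the first graph on its path at which
a reduction with `k > i` takes place (or of the leaf itself, if there is none). -/
def ReductionTree.leaves :
    {G : MGraph (Fin (n + 1)) E} → ReductionTree G → Multiset (LeafRecord n E)
  | _, .leaf G _ => {⟨G, ∅, G.degArray⟩}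
  | _, .node G (r₂ := r₂) _ t₁ t₂ t₃ =>
      (t₁.leaves + t₂.leaves +
        t₃.leaves.map fun L : LeafRecord n E => { L with labels := insert r₂ L.labels }).map
      fun L : LeafRecord n E => { L with
        arr := fun i j => if i < (G.tgt r₂ : ℕ) then G.degArray i j else L.arr i j }

/-- The multiset of left-degree sequences of the leaves of a reduction tree. -/
def ReductionTree.inSeq {G : MGraph (Fin (n + 1)) E} (T : ReductionTree G) :
    Multiset (Fin n → ℤ) :=
  T.leaves.map fun L => L.graph.leftDegSeq

/-- `LD(G,F)`: the multiset of left-degree sequences of the leaves that are assigned the label set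
`F`. -/
def ReductionTree.LD {G : MGraph (Fin (n + 1)) E} (T : ReductionTree G) (F : Finset E) :
    Multiset (Fin n → ℤ) :=
  (T.leaves.filter fun L => L.labels = F).map fun L => L.graph.leftDegSeq

/-! ### Constraint arrays -/

/-- The number of copies of the edge `(j, i)` in `G`. -/
def mult (G : MGraph (Fin (n + 1)) E) (j i : ℕ) : ℕ :=
  #{e ∈ G.edges | (G.src e : ℕ) = j ∧ (G.tgt e : ℕ) = i}

/-- The number of edges of `G[0,i]`. -/
def numEdgesUpTo (G : MGraph (Fin (n + 1)) E) (i : ℕ) : ℕ :=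
  #{e ∈ G.edges | (G.tgt e : ℕ) ≤ i}

/-- `f_{i,j} = #{(j, k) ∈ F : k ≤ i}`. -/
def fnum (G : MGraph (Fin (n + 1)) E) (F : Finset E) (i j : ℕ) : ℕ :=
  #{e ∈ F | (G.src e : ℕ) = j ∧ (G.tgt e : ℕ) ≤ i}

/-- The pairs and superscripts for which there is a variable `a_{i,j}^{(m)}`: `1 ≤ j ≤ i ≤ n`, and
`m` runs from `1` to the number of copies of `(j, i)`, but at least to `1`. -/
def IsVar (G : MGraph (Fin (n + 1)) E) (i j m : ℕ) : Prop :=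
  1 ≤ j ∧ j ≤ i ∧ i ≤ n ∧ 1 ≤ m ∧ m ≤ max 1 (G.mult j i)

/-- `Sol_G(F)`: the integer solution arrays `a i j m = a_{i,j}^{(m)}` of the constraint array
`Tri_G(F)`. Arrays are extended by `0` to all triples `i`, `j`, `m`. -/
structure IsSol (G : MGraph (Fin (n + 1)) E) (F : Finset E) (a : ℕ → ℕ → ℕ → ℤ) : Prop where
  outside : ∀ i j m, ¬ G.IsVar i j m → a i j m = 0
  left : ∀ j, 1 ≤ j → j ≤ n → (G.fnum F n j : ℤ) ≤ a n j 1 + G.fnum F n j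
  nonedge : ∀ i j, 1 ≤ j → j < i → i ≤ n → G.mult j i = 0 →
    a i j 1 + G.fnum F i j = a (i - 1) j 1 + G.fnum F (i - 1) j
  copies : ∀ i j m, 1 ≤ j → j < i → i ≤ n → 1 ≤ m → m < G.mult j i →
    a i j m + G.fnum F i j ≤ a i j (m + 1) + G.fnum F i j
  edge : ∀ i j, 1 ≤ j → j < i → i ≤ n → 0 < G.mult j i →
    a i j (G.mult j i) + G.fnum F i j ≤ a (i - 1) j 1 + G.fnum F (i - 1) j
  diag : ∀ i, 1 ≤ i → i ≤ n →
    a i i 1 + G.fnum F i i =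
      (G.numEdgesUpTo i : ℤ) - ∑ k ∈ Finset.Ico 1 i, (a i k 1 + (G.fnum F i k : ℤ))

/-- `Sol_G(F)` as a set. -/
def solSet (G : MGraph (Fin (n + 1)) E) (F : Finset E) : Set (ℕ → ℕ → ℕ → ℤ) :=
  {a | G.IsSol F a}

theorem solSet_finite (G : MGraph (Fin (n + 1)) E) (F : Finset E) : (G.solSet F).Finite := by
  let N : ℤ := G.numEdgesUpTo n
  have key : ∀ a ∈ G.solSet F, ∀ i j m, 0 ≤ a i j m ∧ a i j m ≤ N := by
    intro a ha
    have ha' : G.IsSol F a := ha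
    have step : ∀ i j, 1 ≤ j → j < i → i ≤ n → ∀ m, 1 ≤ m → m ≤ max 1 (G.mult j i) →
        a i j 1 + G.fnum F i j ≤ a i j m + G.fnum F i j ∧
        a i j m + G.fnum F i j ≤ a (i - 1) j 1 + G.fnum F (i - 1) j := by
      intro i j hj hji hi m hm hm'
      rcases Nat.eq_zero_or_pos (G.mult j i) with h0 | h0
      · obtain rfl : m = 1 := by omega
        exact ⟨le_rfl, (ha'.nonedge i j hj hji hi h0).le⟩
      · have hm2 : m ≤ G.mult j i := by omega
        constructor
        · clear hm'
          induction m, hm using Nat.le_induction with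
          | base => exact le_rfl
          | succ m hm ih =>
            exact (ih (by omega)).trans (ha'.copies i j m hj hji hi hm (by omega))
        · refine le_trans ?_ (ha'.edge i j hj hji hi h0)
          have : ∀ d, ∀ m, 1 ≤ m → m + d = G.mult j i →
              a i j m + G.fnum F i j ≤ a i j (G.mult j i) + G.fnum F i j := by
            intro d
            induction d with
            | zero => intro m _ h; rw [← h]; exact le_rfl
            | succ d ih =>
              intro m h1 h
              exact (ha'.copies i j m hj hji hi h1 (by omega)).trans
                (ih (m + 1) (by omega) (by omega))
          exact this (G.mult j i - m) m hm (by omega)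
    have lower : ∀ j, 1 ≤ j → ∀ d i, i + d = n → j ≤ i →
        (G.fnum F n j : ℤ) ≤ a i j 1 + G.fnum F i j := by
      intro j hj d
      induction d with
      | zero =>
        intro i h hji
        obtain rfl : i = n := by omega
        exact ha'.left j hj hji
      | succ d ih =>
        intro i h hji
        have h1 := ih (i + 1) (by omega) (by omega)
        have h2 := (step (i + 1) j hj (by omega) (by omega) 1 le_rfl (by omega)).2
        simp only [Nat.add_sub_cancel] at h2
        exact h1.trans h2
    have mono : ∀ i j, i ≤ n → G.fnum F i j ≤ G.fnum F n j := by
      intro i j hi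
      apply Finset.card_le_card
      intro e he
      simp only [Finset.mem_filter] at he ⊢
      exact ⟨he.1, he.2.1, he.2.2.trans hi⟩
    have top : ∀ i, 1 ≤ i → i ≤ n → a i i 1 + G.fnum F i i ≤ N := by
      intro i h1 h2
      rw [ha'.diag i h1 h2]
      have h3 : 0 ≤ ∑ k ∈ Finset.Ico 1 i, (a i k 1 + (G.fnum F i k : ℤ)) := by
        refine Finset.sum_nonneg fun k hk => ?_
        rw [Finset.mem_Ico] at hk
        exact le_trans (by positivity) (lower k hk.1 (n - i) i (by omega) hk.2.le)
      have h4 : G.numEdgesUpTo i ≤ G.numEdgesUpTo n := by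
        apply Finset.card_le_card
        intro e he
        simp only [Finset.mem_filter] at he ⊢
        exact ⟨he.1, he.2.trans h2⟩
      have h5 : (G.numEdgesUpTo i : ℤ) ≤ N := Int.ofNat_le.2 h4
      omega
    have upper : ∀ j, 1 ≤ j → ∀ i, j ≤ i → i ≤ n → a i j 1 + G.fnum F i j ≤ N := by
      intro j hj i hji
      induction i, hji using Nat.le_induction with
      | base => exact fun h => top j hj h
      | succ i hji ih =>
        intro h
        have h2 := (step (i + 1) j hj (by omega) h 1 le_rfl (by omega)).2
        simp only [Nat.add_sub_cancel] at h2
        exact h2.trans (ih (by omega))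
    intro i j m
    by_cases h : G.IsVar i j m
    · obtain ⟨h1, h2, h3, h4, h5⟩ := h
      have hl := lower j h1 (n - i) i (by omega) h2
      have hm : (G.fnum F i j : ℤ) ≤ G.fnum F n j := by exact_mod_cast mono i j h3
      rcases h2.eq_or_lt with rfl | h2
      · have : G.mult j j = 0 := by
          rw [mult, Finset.card_eq_zero, Finset.filter_eq_empty_iff]
          rintro e he ⟨h6, h7⟩
          have h8 : (G.src e : ℕ) < G.tgt e := G.src_lt_tgt e he
          omega
        obtain rfl : m = 1 := by omega
        have := top j h1 h3
        omega
      · have hs := step i j h1 h2 h3 m h4 h5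
        have hu := upper j h1 (i - 1) (by omega) (by omega)
        omega
    · rw [ha'.outside i j m h]
      exact ⟨le_rfl, by positivity⟩
  let S : Finset ℕ := Finset.range (n + #G.edges + 2)
  have hS : ∀ i j m, G.IsVar i j m → i ∈ S ∧ j ∈ S ∧ m ∈ S := by
    rintro i j m ⟨h1, h2, h3, h4, h5⟩
    have : G.mult j i ≤ #G.edges := Finset.card_filter_le _ _
    simp only [S, Finset.mem_range]
    have h6 : max 1 (G.mult j i) ≤ 1 + #G.edges := by omega
    omega
  let r : (ℕ → ℕ → ℕ → ℤ) → (S → S → S → ℤ) := fun a i j m => a i j m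
  refine Set.Finite.of_finite_image (f := r) ?_ ?_
  · refine (Set.Finite.pi' (t := fun _ : S => {g : S → S → ℤ | ∀ j, g j ∈ {h : S → ℤ | ∀ m,
      h m ∈ Set.Icc 0 N}}) fun _ => Set.Finite.pi' fun _ => Set.Finite.pi' fun _ =>
        Set.finite_Icc _ _).subset ?_
    rintro _ ⟨a, ha, rfl⟩ i j m
    exact key a ha i j m
  · intro a ha b hb hab
    funext i j m
    by_cases h : G.IsVar i j m
    · obtain ⟨hi, hj, hm⟩ := hS i j m h
      exact congrFun (congrFun (congrFun hab ⟨i, hi⟩) ⟨j, hj⟩) ⟨m, hm⟩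
    · rw [IsSol.outside ha i j m h, IsSol.outside hb i j m h]

/-- The multiset `ρ(Sol_G(F))` of first columns `(a_{n,1}^{(1)}, ..., a_{n,n}^{(1)})`. -/
noncomputable def firstColumns (G : MGraph (Fin (n + 1)) E) (F : Finset E) :
    Multiset (Fin n → ℤ) :=
  (G.solSet_finite F).toFinset.val.map fun a j => a n (j + 1) 1

/-- The multiset of triangular arrays `(a_{i,j}^{(1)})` of the elements of `Sol_G(F)`. If `G` is
simple, then these are all variables, and this is `Sol_G(F)` itself. -/
noncomputable def solArrays (G : MGraph (Fin (n + 1)) E) (F : Finset E) :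
    Multiset (ℕ → ℕ → ℤ) :=
  (G.solSet_finite F).toFinset.val.map fun a i j => a i j 1

/-! ### Flows on `G̃ ∖ {s, 0}` -/

/-- The graph `G̃ ∖ {s, 0}`. -/
def tildeMinus (G : MGraph (Fin (n + 1)) E) :
    MGraph (WithBot (WithTop (Fin (n + 1)))) (E ⊕ (Fin (n + 1) ⊕ Fin (n + 1))) :=
  G.tilde.deleteVerts {source, inner 0}

/-- The netflow vector `b_G^F`: `indeg_G(j) - outdeg_F(j)` at `j ∈ [n]` and `-#E(G∖F)` at `t`.
(The values at the deleted vertices `s` and `0` are irrelevant.) -/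
def bvec (G : MGraph (Fin (n + 1)) E) (F : Finset E) : WithBot (WithTop (Fin (n + 1))) → ℤ
  | none => 0
  | some none => -(#(G.edges \ F) : ℤ)
  | some (some j) => (G.indeg j : ℤ) - G.outdegIn F j

theorem sink_edge_mem (G : MGraph (Fin (n + 1)) E) (hG : G.verts = univ) (j : Fin n) :
    Sum.inr (Sum.inr j.succ) ∈ G.tildeMinus.edges := by
  simp [tildeMinus, deleteVerts, tilde, hG]

/-- `ψ`: the values of a flow on the edges `(j, t)`, `j ∈ [n]`. -/
def psi (G : MGraph (Fin (n + 1)) E) (hG : G.verts = univ) (f : G.tildeMinus.edges → ℤ) :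
    Fin n → ℤ :=
  fun j => f ⟨Sum.inr (Sum.inr j.succ), G.sink_edge_mem hG j⟩

/-- The multiset image under `ψ` of the integral flows on `G̃ ∖ {s, 0}` with netflow `b_G^F`. -/
noncomputable def flowProjections (G : MGraph (Fin (n + 1)) E) (hG : G.verts = univ)
    (F : Finset E) : Multiset (Fin n → ℤ) :=
  (G.tildeMinus.integralFlows_finite (G.bvec F)).toFinset.val.map (G.psi hG)

/-- The edge set `E(G∖0)`. -/
def edgesAwayFromZero (G : MGraph (Fin (n + 1)) E) : Finset E := (G.deleteVerts {0}).edges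

end Fin

end MGraph

/-! Everything is encoded by one kind of object, a plan `(φ, F)`: along an edge `e = (j, k)`, `φ e`
of the edges into `j` are diverted to `k`, and one more is absorbed if `e ∈ F`. The only condition
is that no vertex gives away more edges than it receives, that is, `residual` at level `n` is
nonnegative.

Leaves are plans (`exists_plans`). In a special tree the head of `r₂` is minimal among all
reductions, so for a reduction on `r₁ = (i, j)`, `r₂ = (j, k)` no edge enters `i`; edges leaving `i`
are therefore idle in every plan. The three children then correspond to the three disjoint
possibilities for a plan of the parent: `r₂` is idle, `φ r₂ > 0`, or `φ r₂ = 0` and `r₂ ∈ F`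
(`isPlan_red₁_iff`, `isPlan_red₂_iff`, `isPlan_red₃_iff`). A graph without reductions has only the
zero plan, so induction over the tree matches leaves with plans, labels with `F`, and degree arrays
with residuals.

For fixed `F`, plans are solution arrays (`solArrays_eq`): `φ` is the list of gaps in the chains of
inequalities, one gap per copy of an edge, and the diagonal equations count edges. Plans are also
integral flows (`flowProjections_eq`): `φ` is the flow on `G ∖ 0`, and the residual at `j` is the
flow on `(j, t)`. Since all three descriptions use the same plans, the multisets agree with
multiplicity. -/

namespace MGraph

/-! ### Reduction plans and the leaves of special reduction trees. -/

section Plans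

variable {n : ℕ} {E : Type*} [DecidableEq E]

/-- The contribution of an edge `e` to `residual`. -/
def edgeTerm (G : MGraph (Fin (n + 1)) E) (p : (E → ℕ) × Finset E) (i j : ℕ) (e : E) : ℤ :=
  (if (G.tgt e : ℕ) = j then 1 + (p.1 e : ℤ) else 0) -
    if (G.src e : ℕ) = j ∧ (G.tgt e : ℕ) ≤ i then (p.1 e : ℤ) + (if e ∈ p.2 then 1 else 0) else 0

/-- If `p.1 e` in-edges of the source of `e` are diverted along each edge `e`, and one more is
absorbed for each `e ∈ p.2`, then this is the number of edges into `j` that remain after the edges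
which end in vertices up to `i` have been treated. -/
def residual (G : MGraph (Fin (n + 1)) E) (p : (E → ℕ) × Finset E) (i j : ℕ) : ℤ :=
  ∑ e ∈ G.edges, G.edgeTerm p i j e

/-- A reduction plan: `p.1 e` is the number of steps to a second child, and `p.2` the set of the
steps to a third child, on a path in a special reduction tree, in terms of the edge `r₂`. -/
structure IsPlan (G : MGraph (Fin (n + 1)) E) (p : (E → ℕ) × Finset E) : Prop where
  subset : p.2 ⊆ G.edges
  support : ∀ e, e ∉ G.edges → p.1 e = 0
  nonneg : ∀ v : Fin (n + 1), 0 ≤ G.residual p n v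

/-- The triangular array of the residuals. -/
def planArray (G : MGraph (Fin (n + 1)) E) (p : (E → ℕ) × Finset E) (i j : ℕ) : ℤ :=
  if 1 ≤ j ∧ j ≤ i ∧ i ≤ n then G.residual p i j else 0

/-- Without in-edges every term of the residual at `v` is at most `0`, so nonnegativity of the sum
makes each term vanish. All later statements that an edge is idle come from this. -/
theorem IsPlan.eq_zero_of_no_inedge {G : MGraph (Fin (n + 1)) E} {p : (E → ℕ) × Finset E}
    (hp : G.IsPlan p) {v : Fin (n + 1)} (hv : ∀ e ∈ G.edges, G.tgt e ≠ v) {e : E}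
    (he : e ∈ G.edges) (hs : G.src e = v) : p.1 e = 0 ∧ e ∉ p.2 := by
  have h0 := hp.nonneg v
  have hle : ∀ e' ∈ G.edges, G.edgeTerm p n v e' ≤ 0 := by
    intro e' he'
    have h1 : ¬ ((G.tgt e' : ℕ) = v) := fun h => hv e' he' (Fin.ext h)
    rw [edgeTerm, if_neg h1]
    split_ifs <;> omega
  have hsum : G.residual p n v = 0 := le_antisymm (Finset.sum_nonpos hle) h0
  have h2 := (Finset.sum_eq_zero_iff_of_nonpos hle).1 hsum e he
  have h1 : ¬ ((G.tgt e : ℕ) = v) := fun h => hv e he (Fin.ext h)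
  have h3 : (G.src e : ℕ) = v ∧ (G.tgt e : ℕ) ≤ n := ⟨congrArg _ hs, by omega⟩
  rw [edgeTerm, if_neg h1, if_pos h3] at h2
  split_ifs at h2 with h4
  · omega
  · exact ⟨by omega, h4⟩

theorem isPlan_zero (G : MGraph (Fin (n + 1)) E) : G.IsPlan (fun _ => 0, ∅) where
  subset := by simp
  support := by simp
  nonneg v := by
    refine Finset.sum_nonneg fun e _ => ?_
    simp only [edgeTerm]
    split_ifs <;> simp_all

theorem residual_of_forall_eq_zero (G : MGraph (Fin (n + 1)) E) (p : (E → ℕ) × Finset E) {i j : ℕ}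
    (hji : j ≤ i) (h : ∀ e ∈ G.edges, (G.tgt e : ℕ) ≤ i → p.1 e = 0 ∧ e ∉ p.2) :
    G.residual p i j = #{e ∈ G.edges | (G.tgt e : ℕ) = j} := by
  rw [Finset.card_filter, residual, Nat.cast_sum]
  refine Finset.sum_congr rfl fun e he => ?_
  rw [edgeTerm]
  by_cases hi : (G.tgt e : ℕ) ≤ i
  · obtain ⟨h1, h2⟩ := h e he hi
    simp [h1, h2]
  · have h1 : ¬ ((G.tgt e : ℕ) = j) := by omega
    simp [h1, hi]

/-! ### Effect of one reduction on residuals and plans. -/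

section Reduction

variable {G : MGraph (Fin (n + 1)) E} {r₁ r₂ : E} (h : G.IsReducible r₁ r₂)

include h in
theorem IsReducible.ne : r₁ ≠ r₂ := by
  rintro rfl
  have := G.src_lt_tgt _ h.mem₁
  rw [h.comp] at this
  exact lt_irrefl _ this

include h in
theorem IsReducible.sum_edges (w : E → ℤ) :
    ∑ e ∈ G.edges, w e = w r₁ + w r₂ + ∑ e ∈ (G.edges.erase r₂).erase r₁, w e := by
  rw [← Finset.add_sum_erase _ _ h.mem₂,
    ← Finset.add_sum_erase _ _ (mem_erase.2 ⟨h.ne, h.mem₁⟩)]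
  ring

/-- Only the tail of `r₂` moves, and an idle edge contributes nothing at its tail. -/
theorem residual_red₁ {p : (E → ℕ) × Finset E} (h2 : p.1 r₂ = 0) (h2' : r₂ ∉ p.2) (i j : ℕ) :
    (G.red₁ h).residual p i j = G.residual p i j := by
  refine Finset.sum_congr rfl fun e _ => ?_
  by_cases he : e = r₂
  · subst he; simp [edgeTerm, red₁, h2, h2']
  · have hs : (G.red₁ h).src e = G.src e := Function.update_of_ne he _ _
    simp only [edgeTerm, hs]
    rfl

/-- Moving the head of the idle edge `r₁` costs the tail of `r₂` one in-edge and gives one to its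
head, which is what one more unit of `φ r₂` does. The bound `hi` ensures that this loss is already
counted at level `i`. -/
theorem residual_red₂ {φ : E → ℕ} {F : Finset E} (h1 : φ r₁ = 0) (h1' : r₁ ∉ F) {i : ℕ}
    (hi : (G.tgt r₂ : ℕ) ≤ i) (j : ℕ) :
    (G.red₂ h).residual (φ, F) i j = G.residual (Function.update φ r₂ (φ r₂ + 1), F) i j := by
  have hne := h.ne
  have hc : (G.tgt r₁ : ℕ) = G.src r₂ := congrArg _ h.comp
  rw [residual, residual, h.sum_edges]
  change ∑ e ∈ G.edges, _ = _
  rw [h.sum_edges]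
  congr 1
  · simp only [edgeTerm, red₂, Function.update_self, Function.update_of_ne hne,
      Function.update_of_ne hne.symm, h1, h1', hc, hi]
    push_cast
    split_ifs <;> first | omega | simp_all
  · refine Finset.sum_congr rfl fun e he => ?_
    simp only [mem_erase] at he
    simp [edgeTerm, red₂, he.1, he.2.1]

/-- The edge `r₁` replaces the deleted `r₂` at its head, so the only net change is the loss of one
in-edge at the tail of `r₂`: an absorption. -/
theorem residual_red₃ {φ : E → ℕ} {F : Finset E} (h1 : φ r₁ = 0) (h1' : r₁ ∉ F)
    (h2 : φ r₂ = 0) {i : ℕ} (hi : (G.tgt r₂ : ℕ) ≤ i) (j : ℕ) :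
    (G.red₃ h).residual (φ, F) i j = G.residual (φ, insert r₂ F) i j := by
  have hne := h.ne
  have hc : (G.tgt r₁ : ℕ) = G.src r₂ := congrArg _ h.comp
  rw [residual, residual, h.sum_edges]
  change ∑ e ∈ G.edges.erase r₂, _ = _
  rw [← Finset.add_sum_erase _ _ (mem_erase.2 ⟨h.ne, h.mem₁⟩)]
  congr 1
  · simp only [edgeTerm, red₃, Function.update_self, h1, h1', h2, hc, hi, mem_insert, hne]
    push_cast
    split_ifs <;> first | omega | simp_all
  · refine Finset.sum_congr rfl fun e he => ?_
    simp only [mem_erase] at he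
    simp [edgeTerm, red₃, he.1, he.2.1]

variable (h0 : ∀ e ∈ G.edges, G.tgt e ≠ G.src r₁)

include h in
theorem IsReducible.tgt_ne_src : G.tgt r₂ ≠ G.src r₁ :=
  (((G.src_lt_tgt _ h.mem₁).trans_eq h.comp).trans (G.src_lt_tgt _ h.mem₂)).ne'

include h0 in
theorem red₂_tgt_ne (e : E) (he : e ∈ G.edges) : (G.red₂ h).tgt e ≠ G.src r₁ := by
  by_cases h1 : e = r₁
  · subst h1; simpa [red₂] using h.tgt_ne_src
  · simpa [red₂, h1] using h0 e he

-- After the reduction `r₂` starts at the tail of `r₁`, which no edge enters, so it must be idle.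
-- This is the first of three disjoint and exhaustive cases for plans of `G`.
include h0 in
theorem isPlan_red₁_iff {p : (E → ℕ) × Finset E} :
    (G.red₁ h).IsPlan p ↔ G.IsPlan p ∧ p.1 r₂ = 0 ∧ r₂ ∉ p.2 := by
  constructor
  · intro hp
    have h2 := hp.eq_zero_of_no_inedge (v := G.src r₁) h0 (e := r₂) h.mem₂ (by simp [red₁])
    exact ⟨⟨hp.subset, hp.support, fun v => by
      rw [← residual_red₁ h h2.1 h2.2]; exact hp.nonneg v⟩, h2⟩
  · rintro ⟨hp, h2, h2'⟩
    exact ⟨hp.subset, hp.support, fun v => by rw [residual_red₁ h h2 h2']; exact hp.nonneg v⟩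

-- The edge `r₁` leaves a vertex without in-edges both before and after the reduction, hence is idle
-- in both graphs. This handles the plans with positive value at `r₂`.
include h0 in
theorem isPlan_red₂_iff {φ : E → ℕ} {F : Finset E} :
    (G.red₂ h).IsPlan (φ, F) ↔ G.IsPlan (Function.update φ r₂ (φ r₂ + 1), F) := by
  have hn : (G.tgt r₂ : ℕ) ≤ n := by omega
  constructor
  · intro hp
    obtain ⟨h1, h1'⟩ := hp.eq_zero_of_no_inedge (v := G.src r₁) (red₂_tgt_ne h h0) (e := r₁)
      h.mem₁ rfl
    refine ⟨hp.subset, fun e he => ?_, fun v => ?_⟩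
    · have : e ≠ r₂ := fun h' => he (h' ▸ h.mem₂)
      simpa [this] using hp.support e he
    · rw [← residual_red₂ h h1 h1' hn]; exact hp.nonneg v
  · intro hp
    obtain ⟨h1, h1'⟩ := hp.eq_zero_of_no_inedge h0 h.mem₁ rfl
    simp only [Function.update_of_ne h.ne] at h1
    refine ⟨hp.subset, fun e he => ?_, fun v => ?_⟩
    · have : e ≠ r₂ := fun h' => he (h' ▸ h.mem₂)
      simpa [this] using hp.support e he
    · rw [residual_red₂ h h1 h1' hn]; exact hp.nonneg v

-- As `r₂` is no longer an edge of the child, plans of the child vanish on it. Hence exactly the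
-- plans of `G` that absorb at `r₂` and divert nothing along it arise here.
include h0 in
theorem isPlan_red₃_iff {φ : E → ℕ} {F : Finset E} :
    (G.red₃ h).IsPlan (φ, F) ↔ G.IsPlan (φ, insert r₂ F) ∧ φ r₂ = 0 ∧ r₂ ∉ F := by
  have hn : (G.tgt r₂ : ℕ) ≤ n := by omega
  constructor
  · intro hp
    obtain ⟨h1, h1'⟩ := hp.eq_zero_of_no_inedge (v := G.src r₁)
      (fun e he => red₂_tgt_ne h h0 e (mem_of_mem_erase he)) (e := r₁)
      (mem_erase.2 ⟨h.ne, h.mem₁⟩) rfl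
    have h2 : φ r₂ = 0 := hp.support r₂ (notMem_erase _ _)
    refine ⟨⟨?_, fun e he => hp.support e fun h' => he (mem_of_mem_erase h'), fun v => ?_⟩, h2,
      fun h' => notMem_erase _ _ (hp.subset h')⟩
    · exact insert_subset h.mem₂ (hp.subset.trans (erase_subset _ _))
    · rw [← residual_red₃ h h1 h1' h2 hn]; exact hp.nonneg v
  · rintro ⟨hp, h2, h2'⟩
    obtain ⟨h1, h1'⟩ := hp.eq_zero_of_no_inedge h0 h.mem₁ rfl
    replace h1' : r₁ ∉ F := fun h' => h1' (mem_insert_of_mem h')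
    refine ⟨fun e he => mem_erase.2 ⟨fun h' => h2' (h' ▸ he), hp.subset (mem_insert_of_mem he)⟩,
      fun e he => ?_, fun v => ?_⟩
    · by_cases h3 : e = r₂
      · rw [h3]; exact h2
      · exact hp.support e fun h' => he (mem_erase.2 ⟨h3, h'⟩)
    · rw [residual_red₃ h h1 h1' h2 hn]; exact hp.nonneg v

end Reduction

/-! ### Existence of special reduction trees -/

/-- The total shortness of the edges, which drops at each reduction. -/
def shortness (G : MGraph (Fin (n + 1)) E) : ℕ :=
  ∑ e ∈ G.edges, (n + 1 + (G.src e : ℕ) - (G.tgt e : ℕ))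

/-- Choose `r₂` with the lowest possible head and then a longest `r₁` into its tail. Each reduction
lengthens or deletes edges while lengths stay bounded, so this greedy choice terminates. -/
theorem exists_isSpecial (G : MGraph (Fin (n + 1)) E) : ∃ T : ReductionTree G, T.IsSpecial := by
  classical
  induction hm : G.shortness using Nat.strong_induction_on generalizing G with
  | _ m ih =>
    subst hm
    by_cases hred : ∃ r₁ r₂, G.IsReducible r₁ r₂
    · obtain ⟨a, b, hab⟩ := hred
      obtain ⟨r₂, hr₂, hmin₂⟩ := Finset.exists_min_image
        {r ∈ G.edges | ∃ a, G.IsReducible a r} G.tgt ⟨b, mem_filter.2 ⟨hab.mem₂, a, hab⟩⟩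
      obtain ⟨hr₂, a', ha'⟩ := mem_filter.1 hr₂
      obtain ⟨r₁, hr₁, hmin₁⟩ := Finset.exists_min_image
        {r ∈ G.edges | G.tgt r = G.src r₂} G.src ⟨a', mem_filter.2 ⟨ha'.mem₁, ha'.comp⟩⟩
      obtain ⟨hr₁, hc⟩ := mem_filter.1 hr₁
      have h : G.IsReducible r₁ r₂ := ⟨hr₁, hr₂, hc⟩
      have hne := h.ne
      have l1 : (G.src r₁ : ℕ) < G.tgt r₁ := G.src_lt_tgt _ hr₁
      have l2 : (G.src r₂ : ℕ) < G.tgt r₂ := G.src_lt_tgt _ hr₂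
      have hc' : (G.tgt r₁ : ℕ) = G.src r₂ := congrArg _ hc
      have l3 : (G.tgt r₂ : ℕ) < n + 1 := (G.tgt r₂).2
      obtain ⟨t₁, ht₁⟩ := ih (G.red₁ h).shortness (by
        refine Finset.sum_lt_sum (fun e _ => ?_) ⟨r₂, hr₂, ?_⟩
        · by_cases he : e = r₂
          · subst he; simp only [red₁, Function.update_self]; omega
          · simp [red₁, he]
        · simp only [red₁, Function.update_self]; omega) _ rfl
      have hlt₂ : (G.red₂ h).shortness < G.shortness := by
        refine Finset.sum_lt_sum (fun e _ => ?_) ⟨r₁, hr₁, ?_⟩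
        · by_cases he : e = r₁
          · subst he; simp only [red₂, Function.update_self]; omega
          · simp [red₂, he]
        · simp only [red₂, Function.update_self]; omega
      obtain ⟨t₂, ht₂⟩ := ih (G.red₂ h).shortness hlt₂ _ rfl
      -- The third child is the second one with `r₂` erased, so its shortness is no larger.
      obtain ⟨t₃, ht₃⟩ := ih (G.red₃ h).shortness
        ((Finset.sum_le_sum_of_subset (erase_subset _ _)).trans_lt hlt₂) _ rfl
      refine ⟨.node G h t₁ t₂ t₃, fun a b hab => hmin₂ b (mem_filter.2 ⟨hab.mem₂, a, hab⟩),
        fun e he het => hmin₁ e (mem_filter.2 ⟨he, het.trans hc⟩), ht₁, ht₂, ht₃⟩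
    · push Not at hred
      exact ⟨.leaf G hred, trivial⟩

/-! ### The leaves of a special reduction tree -/

/-- The multiset of plans is built along the tree. Being free of repetitions, it determines the
multiset of leaves independently of the choices made in the tree. -/
theorem ReductionTree.exists_plans {G : MGraph (Fin (n + 1)) E} (T : ReductionTree G)
    (hT : T.IsSpecial) : ∃ M : Multiset ((E → ℕ) × Finset E), M.Nodup ∧
      (∀ p, p ∈ M ↔ G.IsPlan p) ∧
      T.leaves.map (fun L => (L.labels, L.arr)) = M.map fun p => (p.2, G.planArray p) := by
  induction T with
  | leaf G hG =>
    -- In an irreducible graph no edge ends where another begins, so every edge is idle.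
    have h0 : ∀ p, G.IsPlan p → ∀ e ∈ G.edges, p.1 e = 0 ∧ e ∉ p.2 := fun p hp e he =>
      hp.eq_zero_of_no_inedge (v := G.src e) (fun e' he' h' => hG e' e ⟨he', he, h'⟩) he rfl
    refine ⟨{(fun _ => 0, ∅)}, Multiset.nodup_singleton _, fun p => ?_, ?_⟩
    · rw [Multiset.mem_singleton]
      refine ⟨fun hp => hp ▸ G.isPlan_zero, fun hp => ?_⟩
      refine Prod.ext (funext fun e => ?_) (Finset.eq_empty_of_forall_notMem fun e he => ?_)
      · by_cases he : e ∈ G.edges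
        · exact (h0 p hp e he).1
        · exact hp.support e he
      · exact (h0 p hp e (hp.subset he)).2 he
    · simp only [leaves, Multiset.map_singleton]
      congr 2
      funext i j
      simp only [degArray, planArray]
      split_ifs with hij
      · rw [residual_of_forall_eq_zero _ _ hij.2.1 (by simp)]
      · rfl
  | node G h t₁ t₂ t₃ ih₁ ih₂ ih₃ =>
    rename_i r₁ r₂
    obtain ⟨hmin, -, hs₁, hs₂, hs₃⟩ := hT
    obtain ⟨M₁, hd₁, hm₁, he₁⟩ := ih₁ hs₁
    obtain ⟨M₂, hd₂, hm₂, he₂⟩ := ih₂ hs₂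
    obtain ⟨M₃, hd₃, hm₃, he₃⟩ := ih₃ hs₃
    -- An edge into the tail of `r₁` would allow a reduction with `r₁` in second place, whose head
    -- lies below that of `r₂`.
    have h0 : ∀ e ∈ G.edges, G.tgt e ≠ G.src r₁ := fun e he het => by
      have h1 := hmin e r₁ ⟨he, h.mem₁, het⟩
      rw [h.comp] at h1
      exact absurd (G.src_lt_tgt _ h.mem₂) (not_lt.2 h1)
    -- These maps turn plans of the second and third child into plans of `G` by recording the step
    -- just taken.
    let u₂ : (E → ℕ) × Finset E → (E → ℕ) × Finset E :=
      fun p => (Function.update p.1 r₂ (p.1 r₂ + 1), p.2)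
    let u₃ : (E → ℕ) × Finset E → (E → ℕ) × Finset E := fun p => (p.1, insert r₂ p.2)
    have hu₂ : Function.Injective u₂ := by
      rintro ⟨φ, F⟩ ⟨φ', F'⟩ hu
      simp only [u₂, Prod.mk.injEq] at hu
      refine Prod.ext (funext fun e => ?_) hu.2
      have h1 := congrFun hu.1 e
      by_cases h2 : e = r₂
      · subst h2; simpa using h1
      · simpa [h2] using h1
    have hr₃ : ∀ p ∈ M₃, p.1 r₂ = 0 ∧ r₂ ∉ p.2 := fun p hp =>
      ((isPlan_red₃_iff h h0).1 ((hm₃ p).1 hp)).2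
    have hr₁ : ∀ p ∈ M₁, p.1 r₂ = 0 ∧ r₂ ∉ p.2 := fun p hp =>
      ((isPlan_red₁_iff h h0).1 ((hm₁ p).1 hp)).2
    have hmem : ∀ p, p ∈ M₁ + M₂.map u₂ + M₃.map u₃ ↔ G.IsPlan p := by
      intro p
      simp only [Multiset.mem_add, Multiset.mem_map]
      constructor
      · rintro ((hp | ⟨q, hq, rfl⟩) | ⟨q, hq, rfl⟩)
        · exact ((isPlan_red₁_iff h h0).1 ((hm₁ p).1 hp)).1
        · exact (isPlan_red₂_iff h h0).1 ((hm₂ q).1 hq)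
        · exact ((isPlan_red₃_iff h h0).1 ((hm₃ q).1 hq)).1
      · intro hp
        by_cases hφ : p.1 r₂ = 0
        · by_cases hF : r₂ ∈ p.2
          · refine .inr ⟨(p.1, p.2.erase r₂), (hm₃ _).2 ((isPlan_red₃_iff h h0).2 ?_), ?_⟩
            · rw [insert_erase hF]; exact ⟨hp, hφ, notMem_erase _ _⟩
            · simp [u₃, insert_erase hF]
          · exact .inl (.inl ((hm₁ p).2 ((isPlan_red₁_iff h h0).2 ⟨hp, hφ, hF⟩)))
        -- The preimage under `u₂` lowers the value at `r₂` by one; the natural subtraction is exact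
        -- because that value is nonzero.
        · have hu : Function.update (Function.update p.1 r₂ (p.1 r₂ - 1)) r₂
              (Function.update p.1 r₂ (p.1 r₂ - 1) r₂ + 1) = p.1 := by
            rw [Function.update_idem, Function.update_self,
              Nat.sub_add_cancel (Nat.pos_of_ne_zero hφ), Function.update_eq_self]
          refine .inl (.inr ⟨(Function.update p.1 r₂ (p.1 r₂ - 1), p.2),
            (hm₂ _).2 ((isPlan_red₂_iff h h0).2 (hu.symm ▸ hp)), ?_⟩)
          simp only [u₂, hu]
    -- By minimality of the head of `r₂`, an edge with head at most `i` has no in-edge at its tail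
    -- and is idle. So the rows that `leaves` overwrites with degrees are already the residuals of
    -- every plan.
    have hlow : ∀ p, G.IsPlan p → ∀ i j, i < (G.tgt r₂ : ℕ) →
        G.planArray p i j = G.degArray i j := by
      intro p hp i j hi
      simp only [degArray, planArray]
      split_ifs with hij
      · refine residual_of_forall_eq_zero _ _ hij.2.1 fun e he hei =>
          hp.eq_zero_of_no_inedge (v := G.src e) (fun e' he' het => ?_) he rfl
        have h1 : (G.tgt r₂ : ℕ) ≤ G.tgt e := hmin e' e ⟨he', he, het⟩
        omega
      · rfl
    refine ⟨_, ?_, hmem, ?_⟩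
    · rw [Multiset.nodup_add, Multiset.nodup_add]
      refine ⟨⟨hd₁, hd₂.map hu₂, ?_⟩, hd₃.map_on fun p hp q hq hpq => ?_, ?_⟩
      · rw [Multiset.disjoint_left]
        intro p hp hp'
        obtain ⟨q, -, rfl⟩ := Multiset.mem_map.1 hp'
        have := (hr₁ _ hp).1
        simp [u₂] at this
      · simp only [u₃, Prod.mk.injEq] at hpq
        refine Prod.ext hpq.1 ?_
        rw [← erase_insert (hr₃ p hp).2, hpq.2, erase_insert (hr₃ q hq).2]
      · rw [Multiset.disjoint_left]
        intro p hp hp'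
        obtain ⟨q, hq, rfl⟩ := Multiset.mem_map.1 hp'
        rcases Multiset.mem_add.1 hp with hp | hp
        · exact (hr₁ _ hp).2 (mem_insert_self _ _)
        · obtain ⟨q', -, hq'⟩ := Multiset.mem_map.1 hp
          have h1 := congrFun (congrArg Prod.fst hq') r₂
          simp [u₂, u₃, (hr₃ q hq).1] at h1
    · let ov : (ℕ → ℕ → ℤ) → ℕ → ℕ → ℤ :=
        fun a i j => if i < (G.tgt r₂ : ℕ) then G.degArray i j else a i j
      have hov : ∀ {H : MGraph (Fin (n + 1)) E} {p q : (E → ℕ) × Finset E}, G.IsPlan q →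
          (∀ i j, (G.tgt r₂ : ℕ) ≤ i → H.residual p i j = G.residual q i j) →
          ov (H.planArray p) = G.planArray q := by
        intro H p q hq hpq
        funext i j
        simp only [ov]
        split_ifs with hi
        · rw [hlow q hq i j hi]
        · simp only [planArray, hpq i j (not_lt.1 hi)]
      have hleaves : (ReductionTree.node G h t₁ t₂ t₃).leaves.map (fun L => (L.labels, L.arr)) =
          ((t₁.leaves.map fun L => (L.labels, L.arr)).map fun x => (x.1, ov x.2)) +
          ((t₂.leaves.map fun L => (L.labels, L.arr)).map fun x => (x.1, ov x.2)) +
          ((t₃.leaves.map fun L => (L.labels, L.arr)).map fun x => (insert r₂ x.1, ov x.2)) := by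
        simp only [leaves, Multiset.map_add, Multiset.map_map, Function.comp_def, ov]
      rw [hleaves, he₁, he₂, he₃]
      simp only [Multiset.map_add, Multiset.map_map, Function.comp_def]
      refine congrArg₂ _ (congrArg₂ _ ?_ ?_) ?_
      · refine Multiset.map_congr rfl fun p hp => Prod.ext rfl ?_
        have h1 := (isPlan_red₁_iff h h0).1 ((hm₁ p).1 hp)
        exact hov h1.1 fun i j _ => residual_red₁ h h1.2.1 h1.2.2 i j
      · refine Multiset.map_congr rfl fun p hp => Prod.ext rfl ?_
        have h1 := (isPlan_red₂_iff h h0).1 ((hm₂ p).1 hp)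
        obtain ⟨h2, h3⟩ := h1.eq_zero_of_no_inedge h0 h.mem₁ rfl
        simp only [Function.update_of_ne h.ne] at h2
        exact hov h1 fun i j hi => residual_red₂ h h2 h3 hi j
      · refine Multiset.map_congr rfl fun p hp => Prod.ext rfl ?_
        have h1 := (isPlan_red₃_iff h h0).1 ((hm₃ p).1 hp)
        obtain ⟨h2, h3⟩ := h1.1.eq_zero_of_no_inedge h0 h.mem₁ rfl
        exact hov h1.1 fun i j hi => residual_red₃ h h2
          (fun h' => h3 (mem_insert_of_mem h')) h1.2.1 hi j

/-- Heads are at most `n`, so row `n` is never overwritten on the way back to the root. -/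
theorem ReductionTree.leftDegSeq_eq {G : MGraph (Fin (n + 1)) E} (T : ReductionTree G) :
    ∀ L ∈ T.leaves, L.graph.leftDegSeq = fun j : Fin n => L.arr n (j + 1) := by
  induction T with
  | leaf G hG =>
    intro L hL
    rw [leaves, Multiset.mem_singleton] at hL
    subst hL
    funext j
    have : 1 ≤ (j : ℕ) + 1 ∧ (j : ℕ) + 1 ≤ n ∧ n ≤ n := by omega
    simp only [leftDegSeq, indeg, degArray, if_pos this, Fin.ext_iff, Fin.val_succ]
  | node G h t₁ t₂ t₃ ih₁ ih₂ ih₃ =>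
    rename_i r₁ r₂
    intro L hL
    have hn : ¬ n < (G.tgt r₂ : ℕ) := by omega
    simp only [leaves, Multiset.mem_map, Multiset.mem_add] at hL
    obtain ⟨L', (hL' | hL') | ⟨L'', hL'', rfl⟩, rfl⟩ := hL
    · simpa only [hn, if_false] using ih₁ L' hL'
    · simpa only [hn, if_false] using ih₂ L' hL'
    · simpa only [hn, if_false] using ih₃ L'' hL''

end Plans

/-! ### Plans and constraint arrays. -/

section Arrays

variable {n : ℕ} {E : Type*} [DecidableEq E]

/-- The copies of the edge `(j, i)`. -/
def copies (G : MGraph (Fin (n + 1)) E) (j i : ℕ) : Finset E :=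
  {e ∈ G.edges | (G.src e : ℕ) = j ∧ (G.tgt e : ℕ) = i}

/-- `residual` without the edges that are absorbed. -/
def carry (G : MGraph (Fin (n + 1)) E) (φ : E → ℕ) (i j : ℕ) : ℤ :=
  ∑ e ∈ G.edges, ((if (G.tgt e : ℕ) = j then 1 + (φ e : ℤ) else 0) -
    if (G.src e : ℕ) = j ∧ (G.tgt e : ℕ) ≤ i then (φ e : ℤ) else 0)

/-- The sum of `φ` over the copies of `(j, i)` of rank less than `m`. -/
def rankSum (G : MGraph (Fin (n + 1)) E) (rank : E → ℕ) (φ : E → ℕ) (j i m : ℕ) : ℤ :=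
  ∑ e ∈ G.copies j i with rank e < m, (φ e : ℤ)

/-- Numbering parallel copies from `1` lets the copy of rank `m` account for the gap after the entry
with superscript `m`. -/
theorem exists_rank (G : MGraph (Fin (n + 1)) E) : ∃ rank : E → ℕ, ∀ j i,
    Set.BijOn rank (G.copies j i) (Set.Icc 1 (G.mult j i)) := by
  have hmem : ∀ e ∈ G.edges, e ∈ G.copies (G.src e) (G.tgt e) := fun e he => by
    simp [copies, he]
  refine ⟨fun e => if he : e ∈ G.edges then
    ((G.copies (G.src e) (G.tgt e)).equivFin ⟨e, hmem e he⟩ : ℕ) + 1 else 0, fun j i => ?_⟩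
  have key : ∀ e (he : e ∈ G.copies j i), (if he : e ∈ G.edges then
      ((G.copies (G.src e) (G.tgt e)).equivFin ⟨e, hmem e he⟩ : ℕ) + 1 else 0) =
      ((G.copies j i).equivFin ⟨e, he⟩ : ℕ) + 1 := by
    intro e he
    obtain ⟨he', rfl, rfl⟩ := mem_filter.1 he
    rw [dif_pos he']
  refine ⟨fun e he => ?_, fun e he e' he' hee' => ?_, fun m hm => ?_⟩
  · simp only [key e he, Set.mem_Icc]
    exact ⟨Nat.le_add_left _ _, ((G.copies j i).equivFin ⟨e, he⟩).2⟩
  · simp only [key e he, key e' he', add_left_inj] at hee'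
    exact congrArg Subtype.val ((G.copies j i).equivFin.injective (Fin.ext hee'))
  · rw [Set.mem_Icc] at hm
    have hm' : m - 1 < #(G.copies j i) := by
      have : #(G.copies j i) = G.mult j i := rfl
      omega
    let e := (G.copies j i).equivFin.symm ⟨m - 1, hm'⟩
    refine ⟨e, e.2, ?_⟩
    simp only [key e e.2, Subtype.coe_eta, e, Equiv.apply_symm_apply]
    omega

variable {G : MGraph (Fin (n + 1)) E} {F : Finset E} {φ : E → ℕ} {rank : E → ℕ}

theorem fnum_eq_sum (hF : F ⊆ G.edges) (i j : ℕ) : (G.fnum F i j : ℤ) =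
    ∑ e ∈ G.edges, if (G.src e : ℕ) = j ∧ (G.tgt e : ℕ) ≤ i then (if e ∈ F then 1 else 0) else 0 := by
  rw [fnum, Finset.card_filter, Nat.cast_sum, ← Finset.sum_subset hF]
  · refine Finset.sum_congr rfl fun e he => ?_
    simp [he]
  · intro e _ he
    simp [he]

theorem residual_eq_carry_sub (hF : F ⊆ G.edges) (i j : ℕ) :
    G.residual (φ, F) i j = G.carry φ i j - G.fnum F i j := by
  rw [fnum_eq_sum hF, residual, carry, ← Finset.sum_sub_distrib]
  refine Finset.sum_congr rfl fun e _ => ?_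
  simp only [edgeTerm]
  split_ifs <;> ring

/-- Passing from level `i - 1` to `i`, vertex `j` loses exactly what the copies of `(j, i)` divert.
-/
theorem carry_sub_one {i j : ℕ} (hi : 1 ≤ i) :
    G.carry φ (i - 1) j = G.carry φ i j + ∑ e ∈ G.copies j i, (φ e : ℤ) := by
  rw [copies, Finset.sum_filter, carry, carry, ← Finset.sum_add_distrib]
  refine Finset.sum_congr rfl fun e _ => ?_
  split_ifs <;> omega

theorem carry_self (j : ℕ) : G.carry φ j j =
    #{e ∈ G.edges | (G.tgt e : ℕ) = j} + ∑ e ∈ G.edges with (G.tgt e : ℕ) = j, (φ e : ℤ) := by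
  rw [Finset.card_filter, Nat.cast_sum, Finset.sum_filter, carry, ← Finset.sum_add_distrib]
  refine Finset.sum_congr rfl fun e he => ?_
  have : (G.src e : ℕ) < G.tgt e := G.src_lt_tgt e he
  split_ifs <;> omega

/-- Diversion conserves edges: for an edge with head at most `i`, the `φ e` gained at the head
cancels the loss at the tail, leaving `1`. Tail `0` lies outside the summation range, hence `h0`. -/
theorem sum_carry (h0 : ∀ e ∈ G.edges, (G.src e : ℕ) = 0 → φ e = 0) (i : ℕ) :
    ∑ k ∈ Ico 1 (i + 1), G.carry φ i k = G.numEdgesUpTo i := by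
  simp only [carry]
  rw [Finset.sum_comm, numEdgesUpTo, Finset.card_filter, Nat.cast_sum]
  refine Finset.sum_congr rfl fun e he => ?_
  have hlt : (G.src e : ℕ) < G.tgt e := G.src_lt_tgt e he
  have h1 : ∑ k ∈ Ico 1 (i + 1), (if (G.tgt e : ℕ) = k then 1 + (φ e : ℤ) else 0) =
      if (G.tgt e : ℕ) ≤ i then 1 + (φ e : ℤ) else 0 := by
    rw [Finset.sum_ite_eq]
    simp only [mem_Ico]
    congr 1
    exact propext ⟨fun h => by omega, fun h => by omega⟩
  have h2 : ∑ k ∈ Ico 1 (i + 1),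
      (if (G.src e : ℕ) = k ∧ (G.tgt e : ℕ) ≤ i then (φ e : ℤ) else 0) =
      if (G.tgt e : ℕ) ≤ i then (φ e : ℤ) else 0 := by
    simp only [ite_and]
    rw [Finset.sum_ite_eq]
    by_cases hs : (G.src e : ℕ) = 0
    · simp [h0 e he hs]
    · simp only [mem_Ico]
      split_ifs <;> omega
  rw [Finset.sum_sub_distrib, h1, h2]
  split_ifs <;> simp

section Rank

variable (hrank : ∀ j i, Set.BijOn rank (G.copies j i) (Set.Icc 1 (G.mult j i)))

include hrank in
theorem rankSum_one (j i : ℕ) : G.rankSum rank φ j i 1 = 0 := by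
  refine Finset.sum_eq_zero fun e he => ?_
  obtain ⟨he, h1⟩ := mem_filter.1 he
  have h2 := (hrank j i).mapsTo he
  rw [Set.mem_Icc] at h2
  omega

include hrank in
theorem rankSum_rank_add_one {j i : ℕ} {e : E} (he : e ∈ G.copies j i) :
    G.rankSum rank φ j i (rank e + 1) = G.rankSum rank φ j i (rank e) + φ e := by
  have : {e' ∈ G.copies j i | rank e' < rank e + 1} =
      insert e {e' ∈ G.copies j i | rank e' < rank e} := by
    ext e'
    simp only [mem_filter, mem_insert]
    constructor
    · rintro ⟨h1, h2⟩
      rcases (Nat.lt_succ_iff_lt_or_eq.1 h2) with h3 | h3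
      · exact .inr ⟨h1, h3⟩
      · exact .inl ((hrank j i).injOn h1 he h3)
    · rintro (rfl | ⟨h1, h2⟩)
      · exact ⟨he, by omega⟩
      · exact ⟨h1, by omega⟩
  rw [rankSum, this, Finset.sum_insert (by simp), add_comm, rankSum]

theorem rankSum_mono (j i : ℕ) {m m' : ℕ} (h : m ≤ m') :
    G.rankSum rank φ j i m ≤ G.rankSum rank φ j i m' := by
  refine Finset.sum_le_sum_of_subset_of_nonneg (fun e he => ?_) fun _ _ _ => by positivity
  rw [mem_filter] at he ⊢
  exact ⟨he.1, he.2.trans_le h⟩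

include hrank in
theorem rankSum_top (j i : ℕ) :
    G.rankSum rank φ j i (G.mult j i + 1) = ∑ e ∈ G.copies j i, (φ e : ℤ) := by
  rw [rankSum, Finset.filter_true_of_mem]
  intro e he
  have h2 := (hrank j i).mapsTo he
  rw [Set.mem_Icc] at h2
  omega

end Rank

open Classical in
/-- The solution array that belongs to a plan `(φ, F)`. -/
noncomputable def planSol (G : MGraph (Fin (n + 1)) E) (rank : E → ℕ)
    (p : (E → ℕ) × Finset E) (i j m : ℕ) : ℤ :=
  if G.IsVar i j m then G.residual p i j + G.rankSum rank p.1 j i m else 0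

theorem isVar_one {i j : ℕ} (h1 : 1 ≤ j) (h2 : j ≤ i) (h3 : i ≤ n) : G.IsVar i j 1 :=
  ⟨h1, h2, h3, le_rfl, le_max_left _ _⟩

theorem planSol_one (hrank : ∀ j i, Set.BijOn rank (G.copies j i) (Set.Icc 1 (G.mult j i)))
    (p : (E → ℕ) × Finset E) (i j : ℕ) : G.planSol rank p i j 1 = G.planArray p i j := by
  rw [planSol, planArray]
  by_cases h : 1 ≤ j ∧ j ≤ i ∧ i ≤ n
  · rw [if_pos h, if_pos (isVar_one h.1 h.2.1 h.2.2), rankSum_one hrank, add_zero]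
  · rw [if_neg h, if_neg fun h' => h ⟨h'.1, h'.2.1, h'.2.2.1⟩]

theorem IsPlan.eq_zero_of_src_eq_zero {p : (E → ℕ) × Finset E} (hp : G.IsPlan p) {e : E}
    (he : e ∈ G.edges) (hs : (G.src e : ℕ) = 0) : p.1 e = 0 ∧ e ∉ p.2 := by
  refine hp.eq_zero_of_no_inedge (v := 0) (fun e' he' h => ?_) he (Fin.ext hs)
  have := G.src_lt_tgt e' he'
  rw [h] at this
  exact absurd this (Fin.not_lt_zero _)

/-- Once `fnum` is added, an entry is `carry` plus a partial sum of `φ` over copies. The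
inequalities say that partial sums increase, with the full sum reaching the previous row, and the
diagonal equation is `sum_carry`. -/
theorem planSol_isSol (hrank : ∀ j i, Set.BijOn rank (G.copies j i) (Set.Icc 1 (G.mult j i)))
    (hp : G.IsPlan (φ, F)) : G.IsSol F (G.planSol rank (φ, F)) := by
  have hF : F ⊆ G.edges := hp.subset
  have val : ∀ {i j m}, G.IsVar i j m → G.planSol rank (φ, F) i j m + G.fnum F i j =
      G.carry φ i j + G.rankSum rank φ j i m := by
    intro i j m h
    rw [planSol, if_pos h, residual_eq_carry_sub hF]
    ring
  have val1 : ∀ {i j}, 1 ≤ j → j ≤ i → i ≤ n →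
      G.planSol rank (φ, F) i j 1 + G.fnum F i j = G.carry φ i j := by
    intro i j h1 h2 h3
    rw [val (isVar_one h1 h2 h3), rankSum_one hrank, add_zero]
  refine ⟨fun i j m h => if_neg h, ?_, ?_, ?_, ?_, ?_⟩
  · intro j h1 h2
    have h3 := hp.nonneg ⟨j, by omega⟩
    rw [residual_eq_carry_sub hF] at h3
    rw [val1 h1 h2 le_rfl]
    simpa using h3
  · intro i j h1 h2 h3 h4
    rw [val1 h1 h2.le h3, val1 h1 (by omega) (by omega), carry_sub_one (by omega)]
    have : G.copies j i = ∅ := Finset.card_eq_zero.1 h4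
    simp [this]
  · intro i j m h1 h2 h3 h4 h5
    rw [val ⟨h1, h2.le, h3, h4, by omega⟩, val ⟨h1, h2.le, h3, by omega, by omega⟩]
    gcongr
    exact rankSum_mono j i (Nat.le_succ m)
  · intro i j h1 h2 h3 h4
    rw [val ⟨h1, h2.le, h3, h4, le_max_right _ _⟩, val1 h1 (by omega) (by omega),
      carry_sub_one (by omega), ← rankSum_top hrank]
    gcongr
    exact rankSum_mono j i (Nat.le_succ _)
  · intro i h1 h2
    have h3 := sum_carry (φ := φ) (fun e he hs => (hp.eq_zero_of_src_eq_zero he hs).1) i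
    rw [Finset.sum_Ico_succ_top h1] at h3
    have h4 : ∑ k ∈ Ico 1 i, (G.planSol rank (φ, F) i k 1 + (G.fnum F i k : ℤ)) =
        ∑ k ∈ Ico 1 i, G.carry φ i k := by
      refine Finset.sum_congr rfl fun k hk => ?_
      rw [mem_Ico] at hk
      exact val1 hk.1 hk.2.le h2
    rw [h4, val1 h1 le_rfl h2]
    linarith

/-- The array determines all partial sums of `φ` over parallel copies, and `φ` is their consecutive
differences. -/
theorem planSol_injOn (hrank : ∀ j i, Set.BijOn rank (G.copies j i) (Set.Icc 1 (G.mult j i)))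
    {φ' : E → ℕ} (hp : G.IsPlan (φ, F)) (hp' : G.IsPlan (φ', F))
    (h : G.planSol rank (φ, F) = G.planSol rank (φ', F)) : φ = φ' := by
  have hF : F ⊆ G.edges := hp.subset
  have hc : ∀ {i j}, 1 ≤ j → j ≤ i → i ≤ n → G.carry φ i j = G.carry φ' i j := by
    intro i j h1 h2 h3
    have h4 := congrFun (congrFun (congrFun h i) j) 1
    simp only [planSol_one hrank, planArray, if_pos (And.intro h1 (And.intro h2 h3)),
      residual_eq_carry_sub hF] at h4
    linarith
  have hr : ∀ {i j m}, 1 ≤ j → j < i → i ≤ n → 1 ≤ m → m ≤ G.mult j i + 1 →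
      G.rankSum rank φ j i m = G.rankSum rank φ' j i m := by
    intro i j m h1 h2 h3 h4 h5
    rcases h5.eq_or_lt with rfl | h5
    -- No variable has superscript `mult + 1`; this full sum is read off from the previous row
    -- instead.
    · have h6 := carry_sub_one (G := G) (φ := φ) (i := i) (j := j) (by omega)
      have h7 := carry_sub_one (G := G) (φ := φ') (i := i) (j := j) (by omega)
      rw [hc h1 (by omega) (by omega), hc h1 h2.le h3] at h6
      rw [rankSum_top hrank, rankSum_top hrank]
      linarith
    · have h6 := congrFun (congrFun (congrFun h i) j) m
      have hv : G.IsVar i j m := ⟨h1, h2.le, h3, h4, by omega⟩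
      simp only [planSol, if_pos hv, residual_eq_carry_sub hF, hc h1 h2.le h3] at h6
      linarith
  funext e
  by_cases he : e ∈ G.edges
  · by_cases hs : (G.src e : ℕ) = 0
    · exact (hp.eq_zero_of_src_eq_zero he hs).1.trans (hp'.eq_zero_of_src_eq_zero he hs).1.symm
    · have hlt : (G.src e : ℕ) < G.tgt e := G.src_lt_tgt e he
      have hm : e ∈ G.copies (G.src e) (G.tgt e) := by simp [copies, he]
      have hk := (hrank _ _).mapsTo hm
      rw [Set.mem_Icc] at hk
      have h1 := rankSum_rank_add_one (φ := φ) hrank hm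
      have h2 := rankSum_rank_add_one (φ := φ') hrank hm
      rw [hr (by omega) hlt (by omega) (by omega) (by omega),
        hr (by omega) hlt (by omega) hk.1 (by omega)] at h1
      have : (φ e : ℤ) = φ' e := by linarith
      exact_mod_cast this
  · exact (hp.support e he).trans (hp'.support e he).symm

/-- Take `φ` to be the gaps of the chains. The off-diagonal entries are then recovered by
telescoping, and the diagonal equations fix where each column starts. -/
theorem exists_planSol_eq (hrank : ∀ j i, Set.BijOn rank (G.copies j i) (Set.Icc 1 (G.mult j i)))
    (hF : F ⊆ G.edgesAwayFromZero) {a : ℕ → ℕ → ℕ → ℤ} (ha : G.IsSol F a) :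
    ∃ φ, G.IsPlan (φ, F) ∧ G.planSol rank (φ, F) = a := by
  have hF' : F ⊆ G.edges := hF.trans (filter_subset _ _)
  -- The member of the chain that follows superscript `m`; after the last copy it lies in row `i -
  -- 1`.
  let next : ℕ → ℕ → ℕ → ℤ := fun i j m =>
    if m < G.mult j i then a i j (m + 1) + G.fnum F i j else a (i - 1) j 1 + G.fnum F (i - 1) j
  let φ : E → ℕ := fun e => if e ∈ G.edges ∧ (G.src e : ℕ) ≠ 0 then
    (next (G.tgt e) (G.src e) (rank e) -
      (a (G.tgt e) (G.src e) (rank e) + G.fnum F (G.tgt e) (G.src e))).toNat else 0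
  have h0 : ∀ e ∈ G.edges, (G.src e : ℕ) = 0 → φ e = 0 := fun e _ hs =>
    if_neg fun h => h.2 hs
  have hφ : ∀ {i j e}, 1 ≤ j → j < i → i ≤ n → e ∈ G.copies j i →
      (φ e : ℤ) = next i j (rank e) - (a i j (rank e) + G.fnum F i j) := by
    intro i j e h1 h2 h3 he
    have hk := (hrank _ _).mapsTo he
    rw [Set.mem_Icc] at hk
    obtain ⟨he', rfl, rfl⟩ := mem_filter.1 he
    have hs : e ∈ G.edges ∧ (G.src e : ℕ) ≠ 0 := ⟨he', by omega⟩
    simp only [φ, if_pos hs]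
    refine Int.toNat_of_nonneg (sub_nonneg.2 ?_)
    simp only [next]
    split_ifs with hlt
    · exact ha.copies _ _ _ h1 h2 h3 hk.1 hlt
    · have h4 := ha.edge _ _ h1 h2 h3 (by omega)
      rwa [le_antisymm hk.2 (not_lt.1 hlt)]
  have hsum : ∀ {i j}, 1 ≤ j → j < i → i ≤ n → ∀ m, 1 ≤ m → m ≤ max 1 (G.mult j i) →
      G.rankSum rank φ j i m = a i j m - a i j 1 := by
    intro i j h1 h2 h3 m hm
    induction m, hm using Nat.le_induction with
    | base => intro _; rw [rankSum_one hrank, sub_self]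
    | succ m hm ih =>
      intro hm'
      have hlt : m < G.mult j i := by omega
      obtain ⟨e, he, rfl⟩ := (hrank j i).surjOn (Set.mem_Icc.2 ⟨hm, hlt.le⟩)
      rw [rankSum_rank_add_one hrank he, ih (by omega), hφ h1 h2 h3 he]
      simp only [next, if_pos hlt]
      ring
  have htot : ∀ {i j}, 1 ≤ j → j < i → i ≤ n → a (i - 1) j 1 + G.fnum F (i - 1) j =
      a i j 1 + G.fnum F i j + ∑ e ∈ G.copies j i, (φ e : ℤ) := by
    intro i j h1 h2 h3
    rcases Nat.eq_zero_or_pos (G.mult j i) with hμ | hμ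
    · have : G.copies j i = ∅ := Finset.card_eq_zero.1 hμ
      rw [this, Finset.sum_empty, add_zero, ha.nonedge i j h1 h2 h3 hμ]
    · obtain ⟨e, he, hr⟩ := (hrank j i).surjOn (Set.mem_Icc.2 ⟨hμ, le_rfl⟩)
      rw [← rankSum_top hrank, ← hr, rankSum_rank_add_one hrank he, hφ h1 h2 h3 he, hr,
        hsum h1 h2 h3 _ hμ (le_max_right _ _)]
      simp only [next, lt_irrefl, if_false]
      ring
  -- Column `j` starts on the diagonal: summing `htot` over the earlier columns gives the number of
  -- edges diverted into `j`, and the totals of rows `j - 1` and `j` differ by the in-degree of `j`.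
  -- Below the diagonal both sides drop by the same amount.
  have hcarry : ∀ {j}, 1 ≤ j → ∀ i, j ≤ i → i ≤ n → G.carry φ i j = a i j 1 + G.fnum F i j := by
    intro j hj i hji
    induction i, hji using Nat.le_induction with
    | base =>
      intro hn
      have h1 : ∑ e ∈ G.edges with (G.tgt e : ℕ) = j, (φ e : ℤ) =
          ∑ k ∈ Ico 1 j, ∑ e ∈ G.copies k j, (φ e : ℤ) := by
        simp only [copies, Finset.sum_filter]
        rw [Finset.sum_comm]
        refine Finset.sum_congr rfl fun e he => ?_
        have hlt : (G.src e : ℕ) < G.tgt e := G.src_lt_tgt e he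
        simp only [ite_and]
        rw [Finset.sum_ite_eq]
        by_cases hs : (G.src e : ℕ) = 0
        · simp [h0 e he hs]
        · simp only [mem_Ico]
          split_ifs <;> omega
      have h2 : ∑ k ∈ Ico 1 j, ∑ e ∈ G.copies k j, (φ e : ℤ) =
          ∑ k ∈ Ico 1 j, (a (j - 1) k 1 + (G.fnum F (j - 1) k : ℤ)) -
            ∑ k ∈ Ico 1 j, (a j k 1 + (G.fnum F j k : ℤ)) := by
        rw [← Finset.sum_sub_distrib]
        refine Finset.sum_congr rfl fun k hk => ?_
        rw [mem_Ico] at hk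
        rw [htot hk.1 hk.2 hn]
        ring
      have h3 : ∑ k ∈ Ico 1 j, (a (j - 1) k 1 + (G.fnum F (j - 1) k : ℤ)) =
          G.numEdgesUpTo (j - 1) := by
        obtain ⟨i, rfl⟩ : ∃ i, j = i + 1 := ⟨j - 1, by omega⟩
        -- For `j = 1` the previous row is empty, and no edge ends at `0`.
        rcases Nat.eq_zero_or_pos i with rfl | hi
        · symm
          rw [Nat.cast_eq_zero.2]
          · simp
          rw [numEdgesUpTo, Finset.card_eq_zero, Finset.filter_eq_empty_iff]
          intro e he h4
          have hlt : (G.src e : ℕ) < G.tgt e := G.src_lt_tgt e he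
          omega
        · rw [Finset.sum_Ico_succ_top hi, Nat.add_sub_cancel, ha.diag i hi (by omega)]
          ring
      have h4 : (G.numEdgesUpTo j : ℤ) =
          G.numEdgesUpTo (j - 1) + #{e ∈ G.edges | (G.tgt e : ℕ) = j} := by
        simp only [numEdgesUpTo, Finset.card_filter]
        push_cast
        rw [← Finset.sum_add_distrib]
        refine Finset.sum_congr rfl fun e _ => ?_
        split_ifs <;> omega
      rw [carry_self, h1, h2, h3, ha.diag j hj hn, h4]
      ring
    | succ i hji ih =>
      intro hn
      have h1 := htot hj (i := i + 1) (by omega) hn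
      have h2 := carry_sub_one (G := G) (φ := φ) (i := i + 1) (j := j) (by omega)
      rw [Nat.add_sub_cancel] at h1 h2
      rw [ih (by omega)] at h2
      linarith
  have hres : ∀ {i j}, 1 ≤ j → j ≤ i → i ≤ n → G.residual (φ, F) i j = a i j 1 := by
    intro i j h1 h2 h3
    rw [residual_eq_carry_sub hF', hcarry h1 i h2 h3]
    ring
  refine ⟨φ, ⟨hF', fun e he => ?_, fun v => ?_⟩, ?_⟩
  · simp [φ, he]
  · rcases Nat.eq_zero_or_pos (v : ℕ) with hv | hv
    -- The array has no column for vertex `0`; its residual vanishes because edges leaving `0` have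
    -- `φ = 0` and are not in `F`.
    · refine (Finset.sum_eq_zero fun e he => ?_).ge
      have hlt : (G.src e : ℕ) < G.tgt e := G.src_lt_tgt e he
      have h1 : ¬ ((G.tgt e : ℕ) = v) := by omega
      rw [edgeTerm, if_neg h1]
      split_ifs with h2 h3
      · have h4 := hF h3
        simp only [edgesAwayFromZero, deleteVerts, mem_filter, mem_singleton] at h4
        exact absurd (Fin.ext (h2.1.trans hv)) h4.2.1
      · simp [h0 e he (h2.1.trans hv)]
      · rfl
    · have h1 := ha.left v hv (by omega)
      rw [hres hv (by omega) le_rfl]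
      omega
  · funext i j m
    by_cases hv : G.IsVar i j m
    · obtain ⟨h1, h2, h3, h4, h5⟩ := hv
      rw [planSol, if_pos ⟨h1, h2, h3, h4, h5⟩, hres h1 h2 h3]
      rcases h2.eq_or_lt with rfl | h2
      · have : G.mult j j = 0 := by
          rw [mult, Finset.card_eq_zero, Finset.filter_eq_empty_iff]
          rintro e he ⟨h6, h7⟩
          have h8 : (G.src e : ℕ) < G.tgt e := G.src_lt_tgt e he
          omega
        obtain rfl : m = 1 := by omega
        rw [rankSum_one hrank, add_zero]
      · rw [hsum h1 h2 h3 m h4 h5]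
        ring
    · rw [planSol, if_neg hv, ha.outside i j m hv]

theorem solArrays_eq (hF : F ⊆ G.edgesAwayFromZero) {M : Multiset (E → ℕ)} (hM : M.Nodup)
    (hmem : ∀ φ, φ ∈ M ↔ G.IsPlan (φ, F)) :
    G.solArrays F = M.map fun φ => G.planArray (φ, F) := by
  obtain ⟨rank, hrank⟩ := G.exists_rank
  have h : (G.solSet_finite F).toFinset.val = M.map fun φ => G.planSol rank (φ, F) := by
    refine (Multiset.Nodup.ext (Finset.nodup _) (hM.map_on fun φ hφ φ' hφ' h =>
      planSol_injOn hrank ((hmem φ).1 hφ) ((hmem φ').1 hφ') h)).2 fun a => ?_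
    rw [Finset.mem_val, Set.Finite.mem_toFinset, Multiset.mem_map]
    constructor
    · intro ha
      obtain ⟨φ, h1, h2⟩ := exists_planSol_eq hrank hF ha
      exact ⟨φ, (hmem φ).2 h1, h2⟩
    · rintro ⟨φ, h1, rfl⟩
      exact planSol_isSol hrank ((hmem φ).1 h1)
  rw [solArrays, h, Multiset.map_map]
  refine Multiset.map_congr rfl fun φ _ => ?_
  funext i j
  exact planSol_one hrank _ i j

end Arrays

/-! ### Plans and integral flows. -/

section Flows

variable {n : ℕ} {E : Type*} [DecidableEq E] {G : MGraph (Fin (n + 1)) E} {F : Finset E}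

theorem mem_edgesAwayFromZero {e : E} :
    e ∈ G.edgesAwayFromZero ↔ e ∈ G.edges ∧ G.src e ≠ 0 := by
  simp only [edgesAwayFromZero, deleteVerts, mem_filter, mem_singleton]
  refine ⟨fun h => ⟨h.1, h.2.1⟩, fun h => ⟨h.1, h.2, fun h' => ?_⟩⟩
  have := G.src_lt_tgt e h.1
  rw [h'] at this
  exact Fin.not_lt_zero _ this

theorem IsPlan.subset_edgesAwayFromZero {p : (E → ℕ) × Finset E} (hp : G.IsPlan p) :
    p.2 ⊆ G.edgesAwayFromZero := fun _ he => mem_edgesAwayFromZero.2 ⟨hp.subset he, fun hs =>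
  (hp.eq_zero_of_src_eq_zero (hp.subset he) (congrArg Fin.val hs)).2 he⟩

theorem IsPlan.eq_zero_of_notMem {p : (E → ℕ) × Finset E} (hp : G.IsPlan p) {e : E}
    (he : e ∉ G.edgesAwayFromZero) : p.1 e = 0 := by
  by_cases h : e ∈ G.edges
  · refine (hp.eq_zero_of_src_eq_zero h ?_).1
    rw [mem_edgesAwayFromZero, not_and_not_right] at he
    exact congrArg Fin.val (he h)
  · exact hp.support e h

/-- At level `n` every head is counted, and the definition of the residual becomes flow conservation
with the residual leaving along `(v, t)`. -/
theorem residual_top {φ : E → ℕ} (hF : F ⊆ G.edges) (h0 : ∀ e ∉ G.edgesAwayFromZero, φ e = 0)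
    (v : Fin (n + 1)) : G.residual (φ, F) n v = (G.indeg v : ℤ) - G.outdegIn F v +
      ∑ e ∈ G.edgesAwayFromZero with G.tgt e = v, (φ e : ℤ) -
      ∑ e ∈ G.edgesAwayFromZero with G.src e = v, (φ e : ℤ) := by
  have hsum : ∀ (P : E → Prop) [DecidablePred P],
      ∑ e ∈ G.edgesAwayFromZero with P e, (φ e : ℤ) = ∑ e ∈ G.edges, if P e then (φ e : ℤ) else 0 := by
    intro P _
    rw [Finset.sum_filter]
    refine Finset.sum_subset (filter_subset _ _) fun e _ he => ?_
    rw [h0 e he]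
    simp
  have hout : (G.outdegIn F v : ℤ) = ∑ e ∈ G.edges, if G.src e = v ∧ e ∈ F then 1 else 0 := by
    rw [outdegIn, Finset.card_filter, Nat.cast_sum, ← Finset.sum_subset hF]
    · refine Finset.sum_congr rfl fun e he => ?_
      simp [he]
    · intro e _ he
      simp [he]
  rw [hsum, hsum, hout, indeg, Finset.card_filter, Nat.cast_sum, ← Finset.sum_sub_distrib,
    ← Finset.sum_add_distrib, ← Finset.sum_sub_distrib, residual]
  refine Finset.sum_congr rfl fun e _ => ?_
  have hn : (G.tgt e : ℕ) ≤ n := by omega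
  simp only [edgeTerm, ← Fin.ext_iff, hn, and_true]
  split_ifs <;> first | (simp_all; done) | (push_cast; ring)

theorem IsPlan.residual_zero {p : (E → ℕ) × Finset E} (hp : G.IsPlan p) :
    G.residual p n 0 = 0 := by
  refine Finset.sum_eq_zero fun e he => ?_
  have hlt : (G.src e : ℕ) < G.tgt e := G.src_lt_tgt e he
  have h1 : ¬ ((G.tgt e : ℕ) = 0) := by omega
  rw [edgeTerm, if_neg h1]
  split_ifs with h2 h3
  · exact absurd h3 (hp.eq_zero_of_src_eq_zero he h2.1).2
  · simp [(hp.eq_zero_of_src_eq_zero he h2.1).1]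
  · rfl

/-- Diverted edges cancel between tail and head, so each edge counts `1`, minus `1` if it absorbs.
This is the netflow equation at `t`. -/
theorem IsPlan.sum_residual {p : (E → ℕ) × Finset E} (hp : G.IsPlan p) :
    ∑ v ∈ univ.erase (0 : Fin (n + 1)), G.residual p n v = #(G.edges \ p.2) := by
  have h : ∑ v : Fin (n + 1), G.residual p n v = #(G.edges \ p.2) := by
    simp only [residual]
    rw [Finset.sum_comm, Finset.card_sdiff_of_subset hp.subset,
      Nat.cast_sub (card_le_card hp.subset), Finset.card_eq_sum_ones, ← Finset.filter_mem_eq_inter.trans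
      (inter_eq_right.2 hp.subset), Finset.card_filter, Nat.cast_sum, Nat.cast_sum,
      ← Finset.sum_sub_distrib]
    refine Finset.sum_congr rfl fun e _ => ?_
    have hn : (G.tgt e : ℕ) ≤ n := by omega
    simp only [edgeTerm, ← Fin.ext_iff, hn, and_true, Finset.sum_sub_distrib, Finset.sum_ite_eq,
      mem_univ, if_true]
    push_cast
    ring
  rw [← Finset.add_sum_erase _ _ (mem_univ 0)] at h
  simpa [hp.residual_zero] using h

theorem tildeMinus_edges (hG : G.verts = univ) : G.tildeMinus.edges =
    G.edgesAwayFromZero.disjSum ((∅ : Finset (Fin (n + 1))).disjSum (univ.erase 0)) := by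
  ext x
  rcases x with e | v | v <;>
    simp [tildeMinus, deleteVerts, tilde, hG, edgesAwayFromZero]

theorem mem_tildeMinus_verts (hG : G.verts = univ) {x : WithBot (WithTop (Fin (n + 1)))} :
    x ∈ G.tildeMinus.verts ↔ x = sink ∨ ∃ v, v ≠ 0 ∧ x = inner v := by
  simp only [tildeMinus, deleteVerts, tilde, hG, mem_sdiff, mem_insert, mem_image, mem_univ,
    true_and, mem_singleton, not_or]
  constructor
  · rintro ⟨h1 | h1 | ⟨v, rfl⟩, h2, h3⟩
    · exact absurd h1 h2
    · exact .inl h1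
    · exact .inr ⟨v, fun h => h3 (h ▸ rfl), rfl⟩
  · rintro (rfl | ⟨v, hv, rfl⟩)
    · simp
    · simp [hv]

theorem sum_tildeMinus_edges (hG : G.verts = univ)
    (P : E ⊕ (Fin (n + 1) ⊕ Fin (n + 1)) → Prop) [DecidablePred P]
    (g : E ⊕ (Fin (n + 1) ⊕ Fin (n + 1)) → ℤ) :
    ∑ x : G.tildeMinus.edges with P x.1, g x.1 =
      ∑ e ∈ G.edgesAwayFromZero with P (.inl e), g (.inl e) +
      ∑ v ∈ univ.erase 0 with P (.inr (.inr v)), g (.inr (.inr v)) := by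
  simp only [Finset.sum_filter]
  rw [Finset.sum_coe_sort G.tildeMinus.edges (fun x => if P x then g x else 0),
    tildeMinus_edges hG, Finset.sum_disjSum, Finset.sum_disjSum, Finset.sum_empty, zero_add]

/-- Stated for functions on all edge names, so that the sums over the edges of `tildeMinus` split
into edges of `G ∖ 0` and sink edges. -/
theorem mem_integralFlows_iff (hG : G.verts = univ)
    (g : E ⊕ (Fin (n + 1) ⊕ Fin (n + 1)) → ℤ) :
    (fun x : G.tildeMinus.edges => g x.1) ∈ G.tildeMinus.integralFlows (G.bvec F) ↔
      (∀ e ∈ G.edgesAwayFromZero, 0 ≤ g (.inl e)) ∧ (∀ v ≠ 0, 0 ≤ g (.inr (.inr v))) ∧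
      (∀ v ≠ 0, g (.inr (.inr v)) = (G.indeg v : ℤ) - G.outdegIn F v +
        ∑ e ∈ G.edgesAwayFromZero with G.tgt e = v, g (.inl e) -
        ∑ e ∈ G.edgesAwayFromZero with G.src e = v, g (.inl e)) ∧
      ∑ v ∈ univ.erase (0 : Fin (n + 1)), g (.inr (.inr v)) = #(G.edges \ F) := by
  have hflow : (fun x : G.tildeMinus.edges => g x.1) ∈ G.tildeMinus.integralFlows (G.bvec F) ↔
      (∀ x : G.tildeMinus.edges, 0 ≤ g x.1) ∧ ∀ y ∈ G.tildeMinus.verts,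
        (∑ x : G.tildeMinus.edges with G.tildeMinus.src x.1 = y, g x.1) -
        (∑ x : G.tildeMinus.edges with G.tildeMinus.tgt x.1 = y, g x.1) = G.bvec F y := by
    simp only [integralFlows, flowPolytope, Set.mem_ofPred_eq]
    norm_cast
  have hnonneg : (∀ x : G.tildeMinus.edges, 0 ≤ g x.1) ↔
      (∀ e ∈ G.edgesAwayFromZero, 0 ≤ g (.inl e)) ∧ (∀ v ≠ 0, 0 ≤ g (.inr (.inr v))) := by
    rw [Subtype.forall, tildeMinus_edges hG]
    simp
  have hinner : ∀ v : Fin (n + 1), v ≠ 0 →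
      (∑ x : G.tildeMinus.edges with G.tildeMinus.src x.1 = inner v, g x.1) -
      (∑ x : G.tildeMinus.edges with G.tildeMinus.tgt x.1 = inner v, g x.1) =
      ∑ e ∈ G.edgesAwayFromZero with G.src e = v, g (.inl e) + g (.inr (.inr v)) -
      ∑ e ∈ G.edgesAwayFromZero with G.tgt e = v, g (.inl e) := by
    intro v hv
    rw [sum_tildeMinus_edges hG (fun x => G.tildeMinus.src x = inner v),
      sum_tildeMinus_edges hG (fun x => G.tildeMinus.tgt x = inner v)]
    simp [tildeMinus, deleteVerts, tilde, hv, Finset.sum_filter]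
  have hsink : (∑ x : G.tildeMinus.edges with G.tildeMinus.src x.1 = sink, g x.1) -
      (∑ x : G.tildeMinus.edges with G.tildeMinus.tgt x.1 = sink, g x.1) =
      - ∑ v ∈ univ.erase (0 : Fin (n + 1)), g (.inr (.inr v)) := by
    rw [sum_tildeMinus_edges hG (fun x => G.tildeMinus.src x = sink),
      sum_tildeMinus_edges hG (fun x => G.tildeMinus.tgt x = sink)]
    simp [tildeMinus, deleteVerts, tilde]
  have hbi : ∀ v, G.bvec F (inner v) = (G.indeg v : ℤ) - G.outdegIn F v := fun _ => rfl
  have hbs : G.bvec F sink = -(#(G.edges \ F) : ℤ) := rfl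
  rw [hflow, hnonneg, and_assoc]
  refine and_congr_right fun _ => and_congr_right fun _ => ?_
  constructor
  · intro h
    refine ⟨fun v hv => ?_, ?_⟩
    · have h1 := h (inner v) ((mem_tildeMinus_verts hG).2 (.inr ⟨v, hv, rfl⟩))
      rw [hinner v hv, hbi] at h1
      linarith
    · have h1 := h sink ((mem_tildeMinus_verts hG).2 (.inl rfl))
      rw [hsink, hbs] at h1
      linarith
  · rintro ⟨h1, h2⟩ y hy
    rcases (mem_tildeMinus_verts hG).1 hy with rfl | ⟨v, hv, rfl⟩
    · rw [hsink, hbs, h2]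
    · rw [hinner v hv, hbi, h1 v hv]
      ring

/-- The flow that belongs to a plan. -/
def planFlow (G : MGraph (Fin (n + 1)) E) (p : (E → ℕ) × Finset E) :
    E ⊕ (Fin (n + 1) ⊕ Fin (n + 1)) → ℤ
  | .inl e => p.1 e
  | .inr (.inl _) => 0
  | .inr (.inr v) => G.residual p n v

theorem planFlow_mem (hG : G.verts = univ) {φ : E → ℕ} (hp : G.IsPlan (φ, F)) :
    (fun x : G.tildeMinus.edges => G.planFlow (φ, F) x.1) ∈
      G.tildeMinus.integralFlows (G.bvec F) := by
  rw [mem_integralFlows_iff hG]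
  exact ⟨fun e _ => Int.natCast_nonneg _, fun v _ => hp.nonneg v, fun v _ =>
    residual_top hp.subset (fun _ => hp.eq_zero_of_notMem) v, hp.sum_residual⟩

theorem planFlow_injOn (hG : G.verts = univ) {φ φ' : E → ℕ} (hp : G.IsPlan (φ, F))
    (hp' : G.IsPlan (φ', F)) (h : (fun x : G.tildeMinus.edges => G.planFlow (φ, F) x.1) =
      fun x : G.tildeMinus.edges => G.planFlow (φ', F) x.1) : φ = φ' := by
  funext e
  by_cases he : e ∈ G.edgesAwayFromZero
  · have he' : Sum.inl e ∈ G.tildeMinus.edges := by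
      rw [tildeMinus_edges hG]
      simpa using he
    exact Int.ofNat_inj.1 (congrFun h ⟨.inl e, he'⟩)
  · exact (hp.eq_zero_of_notMem he).trans (hp'.eq_zero_of_notMem he).symm

/-- Restricting the flow to the edges of `G ∖ 0` gives `φ`; conservation identifies the sink values
with residuals, whose nonnegativity is the plan condition. -/
theorem exists_planFlow_eq (hG : G.verts = univ) (hF : F ⊆ G.edgesAwayFromZero)
    {f : G.tildeMinus.edges → ℤ} (hf : f ∈ G.tildeMinus.integralFlows (G.bvec F)) :
    ∃ φ, G.IsPlan (φ, F) ∧ (fun x : G.tildeMinus.edges => G.planFlow (φ, F) x.1) = f := by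
  have hF' : F ⊆ G.edges := hF.trans (filter_subset _ _)
  obtain ⟨g, rfl⟩ : ∃ g : E ⊕ (Fin (n + 1) ⊕ Fin (n + 1)) → ℤ,
      (fun x : G.tildeMinus.edges => g x.1) = f :=
    ⟨fun x => if hx : x ∈ G.tildeMinus.edges then f ⟨x, hx⟩ else 0, by
      funext x
      exact dif_pos x.2⟩
  obtain ⟨h1, h2, h3, -⟩ := (mem_integralFlows_iff hG g).1 hf
  let φ : E → ℕ := fun e => if e ∈ G.edgesAwayFromZero then (g (.inl e)).toNat else 0
  have hφ : ∀ e ∈ G.edgesAwayFromZero, (φ e : ℤ) = g (.inl e) := fun e he => by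
    simp only [φ, if_pos he]
    exact Int.toNat_of_nonneg (h1 e he)
  have hφ0 : ∀ e ∉ G.edgesAwayFromZero, φ e = 0 := fun e he => if_neg he
  have hsum : ∀ (P : E → Prop) [DecidablePred P],
      ∑ e ∈ G.edgesAwayFromZero with P e, (φ e : ℤ) =
        ∑ e ∈ G.edgesAwayFromZero with P e, g (.inl e) := fun P _ =>
    Finset.sum_congr rfl fun e he => hφ e (mem_filter.1 he).1
  have hres : ∀ v : Fin (n + 1), v ≠ 0 → G.residual (φ, F) n v = g (.inr (.inr v)) := by
    intro v hv
    rw [residual_top hF' hφ0, hsum, hsum, h3 v hv]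
  refine ⟨φ, ⟨hF', fun e he => hφ0 e fun h => he (mem_edgesAwayFromZero.1 h).1, fun v => ?_⟩, ?_⟩
  · by_cases hv : v = 0
    · subst hv
      -- Vertex `0` is absent from the flow graph, so its plan condition is checked directly:
      -- nothing leaves it.
      have hout : G.outdegIn F 0 = 0 := by
        rw [outdegIn, Finset.card_eq_zero, Finset.filter_eq_empty_iff]
        exact fun e he => (mem_edgesAwayFromZero.1 (hF he)).2
      have hsrc : ∑ e ∈ G.edgesAwayFromZero with G.src e = 0, (φ e : ℤ) = 0 := by
        rw [Finset.filter_false_of_mem fun e he => (mem_edgesAwayFromZero.1 he).2, sum_empty]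
      rw [residual_top hF' hφ0, hout, hsrc, Nat.cast_zero, sub_zero, sub_zero]
      positivity
    · rw [hres v hv]
      exact h2 v hv
  · funext ⟨x, hx⟩
    rw [tildeMinus_edges hG] at hx
    rcases x with e | v | v
    · exact hφ e (by simpa using hx)
    · simp at hx
    · exact hres v (by simpa using hx)

theorem flowProjections_eq (hG : G.verts = univ) (hF : F ⊆ G.edgesAwayFromZero)
    {M : Multiset (E → ℕ)} (hM : M.Nodup) (hmem : ∀ φ, φ ∈ M ↔ G.IsPlan (φ, F)) :
    G.flowProjections hG F = M.map fun φ (j : Fin n) => G.residual (φ, F) n (j + 1) := by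
  have h : (G.tildeMinus.integralFlows_finite (G.bvec F)).toFinset.val =
      M.map fun φ (x : G.tildeMinus.edges) => G.planFlow (φ, F) x.1 := by
    refine (Multiset.Nodup.ext (Finset.nodup _) (hM.map_on fun φ hφ φ' hφ' h =>
      planFlow_injOn hG ((hmem φ).1 hφ) ((hmem φ').1 hφ') h)).2 fun f => ?_
    rw [Finset.mem_val, Set.Finite.mem_toFinset, Multiset.mem_map]
    constructor
    · intro hf
      obtain ⟨φ, h1, h2⟩ := exists_planFlow_eq hG hF hf
      exact ⟨φ, (hmem φ).2 h1, h2⟩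
    · rintro ⟨φ, h1, rfl⟩
      exact planFlow_mem hG ((hmem φ).1 h1)
  rw [flowProjections, h, Multiset.map_map]
  refine Multiset.map_congr rfl fun φ _ => ?_
  funext j
  simp only [Function.comp_apply, psi, planFlow, Fin.val_succ]

end Flows

end MGraph

/-! ### Sorting the leaves by label set, and the theorem. -/

theorem Multiset.map_eq_sum_filter {α β γ : Type*} [DecidableEq β] (s : Multiset α) (g : α → β)
    (t : Finset β) (h : ∀ x ∈ s, g x ∈ t) (w : α → γ) :
    s.map w = ∑ b ∈ t, (s.filter fun x => g x = b).map w := by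
  induction s using Multiset.induction_on with
  | empty => simp
  | cons a s ih =>
    have h1 : ∀ b, ((a ::ₘ s).filter fun x => g x = b).map w =
        (if g a = b then {w a} else 0) + (s.filter fun x => g x = b).map w := by
      intro b
      rw [Multiset.filter_cons, Multiset.map_add]
      split_ifs <;> simp
    simp only [h1]
    rw [Finset.sum_add_distrib, Finset.sum_ite_eq, if_pos (h a (Multiset.mem_cons_self a s)),
      ← ih fun x hx => h x (Multiset.mem_cons_of_mem hx), Multiset.map_cons,
      Multiset.singleton_add]

theorem MGraph.firstColumns_eq_map_solArrays {n : ℕ} {E : Type*} [DecidableEq E]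
    (G : MGraph (Fin (n + 1)) E) (F : Finset E) :
    G.firstColumns F = (G.solArrays F).map fun a (j : Fin n) => a n (j + 1) := by
  rw [firstColumns, solArrays, Multiset.map_map]
  rfl

theorem mainTheorem4 {n : ℕ} {E : Type*} [DecidableEq E]
    (G : MGraph (Fin (n + 1)) E) (hG : G.verts = Finset.univ) :
    (∃ T : MGraph.ReductionTree G, T.IsSpecial) ∧
    ∀ T : MGraph.ReductionTree G, T.IsSpecial →
      (∀ F ⊆ G.edgesAwayFromZero,
        T.LD F = G.firstColumns F ∧ T.LD F = G.flowProjections hG F) ∧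
      T.inSeq = ∑ F ∈ G.edgesAwayFromZero.powerset, T.LD F ∧
      T.inSeq = ∑ F ∈ G.edgesAwayFromZero.powerset, G.firstColumns F ∧
      T.inSeq = ∑ F ∈ G.edgesAwayFromZero.powerset, G.flowProjections hG F ∧
      ((∀ i j, G.mult j i ≤ 1) →
        T.leaves.map (fun L => L.arr) = ∑ F ∈ G.edgesAwayFromZero.powerset, G.solArrays F) := by
  refine ⟨G.exists_isSpecial, fun T hT => ?_⟩
  obtain ⟨M, hM, hmem, hleaves⟩ := T.exists_plans hT
  have hlab : ∀ L ∈ T.leaves, L.labels ∈ G.edgesAwayFromZero.powerset := by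
    intro L hL
    have h1 := Multiset.mem_map_of_mem (fun L : MGraph.LeafRecord n E => (L.labels, L.arr)) hL
    rw [hleaves, Multiset.mem_map] at h1
    obtain ⟨p, hp, h2⟩ := h1
    have h3 : p.2 = L.labels := congrArg Prod.fst h2
    rw [mem_powerset, ← h3]
    exact ((hmem p).1 hp).subset_edgesAwayFromZero
  -- The fibre of plans over `F`: the common index of the leaves labelled `F`, the solution arrays
  -- and the flows.
  let N : Finset E → Multiset (E → ℕ) := fun F => (M.filter fun p => p.2 = F).map Prod.fst
  have hN : ∀ F, (N F).Nodup := fun F => (hM.filter _).map_on fun p hp q hq h =>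
    Prod.ext h ((Multiset.mem_filter.1 hp).2.trans (Multiset.mem_filter.1 hq).2.symm)
  have hNmem : ∀ F φ, φ ∈ N F ↔ G.IsPlan (φ, F) := by
    intro F φ
    rw [Multiset.mem_map, ← hmem]
    constructor
    · rintro ⟨p, hp, rfl⟩
      obtain ⟨h1, rfl⟩ := Multiset.mem_filter.1 hp
      exact h1
    · exact fun h => ⟨(φ, F), Multiset.mem_filter.2 ⟨h, rfl⟩, rfl⟩
  have harr : ∀ F ⊆ G.edgesAwayFromZero,
      (T.leaves.filter fun L => L.labels = F).map (fun L => L.arr) = G.solArrays F := by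
    intro F hF
    rw [MGraph.solArrays_eq hF (hN F) (hNmem F), Multiset.map_map]
    have h1 := congrArg (fun s => (s.filter fun x => x.1 = F).map Prod.snd) hleaves
    simp only [Multiset.filter_map, Multiset.map_map, Function.comp_def] at h1
    rw [h1]
    refine Multiset.map_congr rfl fun p hp => ?_
    obtain ⟨-, rfl⟩ := Multiset.mem_filter.1 hp
    rfl
  have hLD : ∀ F ⊆ G.edgesAwayFromZero, T.LD F = G.firstColumns F := by
    intro F hF
    rw [MGraph.firstColumns_eq_map_solArrays, ← harr F hF, Multiset.map_map, MGraph.ReductionTree.LD]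
    exact Multiset.map_congr rfl fun L hL => T.leftDegSeq_eq L (Multiset.mem_filter.1 hL).1
  have hflow : ∀ F ⊆ G.edgesAwayFromZero, T.LD F = G.flowProjections hG F := by
    intro F hF
    rw [hLD F hF, MGraph.firstColumns_eq_map_solArrays, MGraph.solArrays_eq hF (hN F) (hNmem F),
      MGraph.flowProjections_eq hG hF (hN F) (hNmem F), Multiset.map_map]
    refine Multiset.map_congr rfl fun φ _ => ?_
    funext j
    exact if_pos ⟨by omega, by omega, le_rfl⟩
  have hseq : T.inSeq = ∑ F ∈ G.edgesAwayFromZero.powerset, T.LD F :=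
    Multiset.map_eq_sum_filter _ _ _ hlab _
  refine ⟨fun F hF => ⟨hLD F hF, hflow F hF⟩, hseq, ?_, ?_, fun _ => ?_⟩
  · exact hseq.trans (Finset.sum_congr rfl fun F hF => hLD F (mem_powerset.1 hF))
  · exact hseq.trans (Finset.sum_congr rfl fun F hF => hflow F (mem_powerset.1 hF))
  · rw [Multiset.map_eq_sum_filter _ _ _ hlab]
    exact Finset.sum_congr rfl fun F hF => harr F (mem_powerset.1 hF)
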